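/- All graphs are finite and simple. A vertex-coloring of a graph (not necessarily proper) is an *MVC-coloring* if any two vertices are joined by a path whose internal vertices all have the same color. For a connected graph $G$, let $mvc(G)$ be the maximum number of colors used in an MVC-coloring of $G$. For integers $n,k$ with $3\le k\le n$, let $f_v(n,k)$ be the least integer $m\ge n-1$ such that every connected graph $G$ with $|V(G)|=n$ and $|E(G)|\ge m$ satisfies $mvc(G)\ge k$ (recall that a connected graph on $n$ vertices has at least $n-1$ edges). **Corollary 3.7.** For all integers $n,k$ with $3\le k\le n$, the number $f_v(n,k)$ exists, and $$f_v(n,k)=\begin{cases} n-1 & \text{if } k=3,\\ n+\binom{k-2}{2} & \text{if } 4\le k\le n-2,\\ n-1+\binom{k-2}{2} & \text{if } n-1\le k\le n.\end{cases}$$ -/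

import Mathlib

/-- A vertex-colouring `c` of `G` (not necessarily proper) is an MVC-colouring if any two vertices
are joined by a vertex-monochromatic path, i.e. a path all of whose internal vertices have the same
colour. -/
def IsMVCColoring {V : Type*} (G : SimpleGraph V) (c : V → ℕ) : Prop :=
  ∀ u v : V, ∃ p : G.Walk u v, p.IsPath ∧
    ∃ a : ℕ, ∀ w ∈ p.support, w ≠ u → w ≠ v → c w = a

/-- The numbers of colours used by the MVC-colourings of `G`. -/
def mvcColorCounts {V : Type*} (G : SimpleGraph V) : Set ℕ :=
  {m | ∃ c : V → ℕ, IsMVCColoring G c ∧ (Set.range c).ncard = m}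

/-- The monochromatic vertex-connection number of a finite connected graph: the maximum number of
colours used in an MVC-colouring. -/
noncomputable def mvc {V : Type*} [Finite V] (G : SimpleGraph V) : ℕ :=
  sSup (mvcColorCounts G)

/-- On a finite connected graph the supremum defining `mvc` is a maximum. -/
theorem mvc_isGreatest {V : Type*} [Finite V] (G : SimpleGraph V) (hG : G.Connected) :
    IsGreatest (mvcColorCounts G) (mvc G) := by
  have hne : (mvcColorCounts G).Nonempty := by
    refine ⟨_, fun _ => 0, fun u v => ?_, rfl⟩
    obtain ⟨p, hp⟩ := (hG.preconnected u v).exists_isPath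
    exact ⟨p, hp, 0, fun _ _ _ _ => rfl⟩
  have hb : BddAbove (mvcColorCounts G) := by
    refine ⟨Nat.card V, ?_⟩
    rintro _ ⟨c, -, rfl⟩
    rw [← Set.image_univ, ← Set.ncard_univ]
    exact Set.ncard_image_le Set.finite_univ
  exact ⟨Nat.sSup_mem hne hb, fun _ hm => le_csSup hb hm⟩

/-- The integers `m ≥ n - 1` such that every connected graph `G` with `n` vertices and at least `m`
edges satisfies `mvc G ≥ k`. (A connected graph with `n` vertices has at least `n - 1` edges, so
smaller `m` impose no condition on the graph and are not considered as edge numbers.) -/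
def forcingEdgeNumbers (n k : ℕ) : Set ℕ :=
  {m | n - 1 ≤ m ∧
    ∀ G : SimpleGraph (Fin n), G.Connected → m ≤ G.edgeSet.ncard → k ≤ mvc G}

/-- The least number of edges that forces `mvc G ≥ k` for connected graphs on `n` vertices. -/
noncomputable def fv (n k : ℕ) : ℕ :=
  sInf (forcingEdgeNumbers n k)

/-!
# Edges that force a large monochromatic vertex-connection number

If a connected vertex set has `b` boundary vertices, it grows to a connected dominating set whose
complement has at least `b` vertices, and giving that set one colour and every other vertex a colour
of its own is an MVC-colouring with at least `b + 1` colours (`card_bd_lt_mvc`). So the upper bounds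
ask for a connected set with a large boundary, that is, for a spanning tree with many leaves.

**Many edges give a large boundary** (`ec_univ_le_of_card_bd_le`). Suppose all boundaries of
connected sets have at most `t` vertices, and `n ≥ t + 3`. Let `v` have maximum degree `t - r`, let
`N` be its neighbourhood and `W` the set of remaining vertices. A neighbour `u` of `v` has at most
`r + 1` neighbours in `W`, as otherwise `{v, u}` has too large a boundary. Degrees count the edges
that meet `N ∪ {v}`, and `CutConn.ec_far_le` bounds the edges inside `W`. That bound comes from a
rooted one, `CutConn.ec_self_le`, proved by deleting neighbours of the root: each of them is a
boundary vertex of every connected set that contains the root and not the neighbour, so that the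
deletion lowers the largest boundary. For `r ≥ 1` the two counts add up to at most
`n - 1 + t.choose 2` edges. For `r = 0` the missing edges come from non-adjacent pairs inside `N`
(`card_far_nbrs_le`).

**The cases `k = n` and `k = n - 1`.** A graph of diameter at most two can be coloured injectively.
Otherwise two vertices `x`, `y` are at distance at least three, so that `n - 1` pairs are
non-adjacent, which settles `k = n`. If moreover no edge is dominating, then the neighbours of `x`
and of `y` lie in one component of the complement even without `x` and `y`, and `2n - 4` pairs are
non-adjacent; and a dominating edge gives `n - 1` colours.

**Lower bounds.** The extremal graphs `cliqueCycle` are a cycle with one vertex blown up to a clique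
of size `k - 3`, when the cycle is long, and otherwise a path with its second vertex blown up. In
both, at most two colours of an MVC-colouring do not occur on the clique, so there are at most
`k - 1` colours.
-/

/-! ### Connected sets, boundaries and edge counts -/

open Finset in
/-- The number of ordered pairs `(x, y)` with `x ∈ A`, `y ∈ B` and `x` adjacent to `y`. For disjoint
`A`, `B` this is the number of edges between them; `ec G A A` is twice the number of edges inside
`A`. -/
noncomputable def ec {V : Type*} (G : SimpleGraph V) (A B : Finset V) : ℕ := by
  classical exact ∑ x ∈ A, #{y ∈ B | G.Adj x y}

/-- A nonempty finite vertex set is connected: each of its nonempty proper subsets has an edge to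
the rest of the set. Stating connectivity by cuts keeps the arguments inside finite sets. -/
def CutConn {V : Type*} (G : SimpleGraph V) (S : Finset V) : Prop :=
  S.Nonempty ∧ ∀ A ⊆ S, A.Nonempty → A ≠ S → ∃ x ∈ A, ∃ y ∈ S, y ∉ A ∧ G.Adj x y

/-- The boundary of `X` in `M`: the vertices of `M` outside `X` with a neighbour in `X`. -/
noncomputable def bd {V : Type*} (G : SimpleGraph V) (M X : Finset V) : Finset V := by
  classical exact M.filter fun y => y ∉ X ∧ ∃ x ∈ X, G.Adj x y

/-- The largest boundary size in `M` of a connected subset of `M` that contains the root `a`. -/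
noncomputable def rho {V : Type*} (G : SimpleGraph V) (M : Finset V) (a : V) : ℕ := by
  classical exact (M.powerset.filter fun X => a ∈ X ∧ CutConn G X).sup fun X => (bd G M X).card

section Basics

variable {V : Type*} {G : SimpleGraph V}

open Finset Classical

theorem ec_union_left {A B C : Finset V} (h : Disjoint A B) :
    ec G (A ∪ B) C = ec G A C + ec G B C := by
  unfold ec; rw [sum_union h]

theorem ec_union_right {A B C : Finset V} (h : Disjoint B C) :
    ec G A (B ∪ C) = ec G A B + ec G A C := by
  unfold ec; rw [← sum_add_distrib]
  refine sum_congr rfl fun x _ => ?_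
  rw [filter_union, card_union_of_disjoint]
  exact disjoint_filter_filter h

theorem ec_comm (A B : Finset V) : ec G A B = ec G B A := by
  unfold ec
  simp_rw [card_filter]
  rw [sum_comm]
  simp_rw [G.adj_comm]

theorem ec_union_self {A B : Finset V} (h : Disjoint A B) :
    ec G (A ∪ B) (A ∪ B) = ec G A A + ec G B B + 2 * ec G A B := by
  rw [ec_union_left h, ec_union_right h, ec_union_right h, ec_comm B A]; ring

theorem ec_singleton_left (x : V) (B : Finset V) : ec G {x} B = #{y ∈ B | G.Adj x y} := by
  simp [ec]

theorem ec_singleton_self (x : V) : ec G {x} {x} = 0 := by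
  simp [ec]

theorem ec_eq_zero {A B : Finset V} (h : ∀ x ∈ A, ∀ y ∈ B, ¬ G.Adj x y) : ec G A B = 0 := by
  unfold ec
  refine sum_eq_zero fun x hx => ?_
  rw [card_eq_zero, filter_eq_empty_iff]
  exact fun y hy => h x hx y hy

theorem mem_bd {M X : Finset V} {y : V} :
    y ∈ bd G M X ↔ y ∈ M ∧ y ∉ X ∧ ∃ x ∈ X, G.Adj x y := by
  simp [bd]

theorem cutConn_singleton (a : V) : CutConn G {a} := by
  refine ⟨singleton_nonempty a, fun A hA hne h => ?_⟩
  rcases subset_singleton_iff.1 hA with rfl | rfl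
  · simp at hne
  · exact absurd rfl h

theorem cutConn_pair {a b : V} (h : G.Adj a b) : CutConn G {a, b} := by
  refine ⟨⟨a, by simp⟩, fun A hA hne hA' => ?_⟩
  by_cases ha : a ∈ A
  · refine ⟨a, ha, b, by simp, fun hb => hA' ?_, h⟩
    refine subset_antisymm hA ?_
    simp [insert_subset_iff, ha, hb]
  · obtain ⟨x, hx⟩ := hne
    have := hA hx
    simp only [mem_insert, mem_singleton] at this
    rcases this with rfl | rfl
    · exact absurd hx ha
    · exact ⟨x, hx, a, by simp, ha, h.symm⟩

theorem CutConn.union {X Y : Finset V} (hX : CutConn G X) (hY : CutConn G Y) {w : V} (hwX : w ∈ X)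
    (hwY : w ∈ Y) : CutConn G (X ∪ Y) := by
  refine ⟨⟨w, by simp [hwX]⟩, fun A hA hne hA' => ?_⟩
  by_contra hcon
  push Not at hcon
  have key : ∀ Z, Z ⊆ X ∪ Y → CutConn G Z → (A ∩ Z).Nonempty → Z ⊆ A := by
    intro Z hZ hc hn
    by_contra hZA
    obtain ⟨x, hx, y, hy, hyA, hadj⟩ := hc.2 (A ∩ Z) inter_subset_right hn
      (fun h => hZA (inter_eq_right.1 h))
    simp only [mem_inter] at hx hyA
    exact hcon x hx.1 y (hZ hy) (fun h => hyA ⟨h, hy⟩) hadj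
  have kX := key X subset_union_left hX
  have kY := key Y subset_union_right hY
  obtain ⟨x, hx⟩ := hne
  have hwA : w ∈ A := by
    rcases mem_union.1 (hA hx) with h | h
    · exact kX ⟨x, by simp [hx, h]⟩ hwX
    · exact kY ⟨x, by simp [hx, h]⟩ hwY
  exact hA' (subset_antisymm hA (union_subset (kX ⟨w, by simp [hwA, hwX]⟩)
    (kY ⟨w, by simp [hwA, hwY]⟩)))

theorem CutConn.union_of_adj {X Y : Finset V} (hX : CutConn G X) (hY : CutConn G Y) {x y : V}
    (hx : x ∈ X) (hy : y ∈ Y) (h : G.Adj x y) : CutConn G (X ∪ Y) := by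
  have h1 := (hX.union (cutConn_pair h) hx (by simp)).union hY (w := y) (by simp) hy
  convert h1 using 1
  ext w; simp only [mem_union, mem_insert, mem_singleton]
  constructor
  · tauto
  · rintro ((h | rfl | rfl) | h) <;> tauto

theorem CutConn.insert_of_adj {X : Finset V} (hX : CutConn G X) {x y : V} (hx : x ∈ X)
    (h : G.Adj x y) : CutConn G (insert y X) := by
  have := hX.union_of_adj (cutConn_singleton y) hx (mem_singleton_self y) h
  rwa [union_comm, ← insert_eq] at this

/-- The component of `a` in `M`. -/
theorem exists_component {M : Finset V} {a : V} (ha : a ∈ M) :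
    ∃ C ⊆ M, a ∈ C ∧ CutConn G C ∧ ∀ x ∈ C, ∀ y ∈ M, y ∉ C → ¬ G.Adj x y := by
  obtain ⟨C, hC, hmax⟩ := exists_max_image (M.powerset.filter fun X => a ∈ X ∧ CutConn G X) card
    ⟨{a}, by simp [ha, cutConn_singleton]⟩
  simp only [mem_filter, mem_powerset] at hC hmax
  refine ⟨C, hC.1, hC.2.1, hC.2.2, fun x hx y hy hyC hadj => ?_⟩
  have := hmax (insert y C) ⟨insert_subset hy hC.1, by simp [hC.2.1], hC.2.2.insert_of_adj hx hadj⟩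
  rw [card_insert_of_notMem hyC] at this
  omega

/-- Removing a neighbour `z` of the root `a` splits a connected set into the component `M'` of the
root and the part `Y` that hangs on `z`. -/
theorem CutConn.exists_split {M : Finset V} (hM : CutConn G M) {a z : V} (ha : a ∈ M) (hz : z ∈ M)
    (haz : a ≠ z) :
    ∃ M' Y : Finset V, M = M' ∪ insert z Y ∧ Disjoint M' (insert z Y) ∧ z ∉ Y ∧ a ∈ M' ∧
      CutConn G M' ∧ CutConn G (insert z Y) ∧ ∀ x ∈ M', ∀ y ∈ Y, ¬ G.Adj x y := by
  obtain ⟨M', hsub, haM', hcM', hno⟩ := exists_component (G := G) (M := M.erase z) (a := a)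
    (by simp [ha, haz])
  have hzM' : z ∉ M' := fun h => by simpa using hsub h
  have hsub' : M' ⊆ M := hsub.trans (erase_subset _ _)
  refine ⟨M', (M.erase z) \ M', ?_, ?_, by simp, haM', hcM', ?_, ?_⟩
  · ext w; simp only [mem_union, mem_insert, mem_sdiff, mem_erase]
    have := @hsub' w
    constructor
    · tauto
    · rintro (h | rfl | h) <;> tauto
  · rw [disjoint_left]; intro w hw
    simp only [mem_insert, mem_sdiff, mem_erase]
    rintro (rfl | h)
    · exact hzM' hw
    · exact h.2 hw
  · obtain ⟨C, hCs, hzC, hcC, hCno⟩ := exists_component (G := G)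
      (M := insert z ((M.erase z) \ M')) (a := z) (by simp)
    by_cases hCe : C = insert z ((M.erase z) \ M')
    · rwa [← hCe]
    · -- A vertex outside the component of `z` has its whole component in `M` cut off.
      exfalso
      obtain ⟨w, hw, hwC⟩ := exists_of_ssubset (hCs.ssubset_of_ne hCe)
      have hwz : w ≠ z := fun h => hwC (h ▸ hzC)
      obtain ⟨x, hx, y, hy, hyA, hadj⟩ := hM.2 (((M.erase z) \ M') \ C)
        (fun w hw => by simp only [mem_sdiff, mem_erase] at hw; exact hw.1.1.2)
        ⟨w, by simp only [mem_insert] at hw; simp only [mem_sdiff] at hw ⊢; tauto⟩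
        (fun h => by rw [← h] at hz; simp at hz)
      simp only [mem_sdiff, mem_erase] at hx hyA
      by_cases hyC : y ∈ C
      · exact hCno y hyC x (by simp [hx]) hx.2 hadj.symm
      · have hyz : y ≠ z := fun h => hyC (h ▸ hzC)
        have hyM' : y ∈ M' := by tauto
        exact hno y hyM' x (by simp [hx]) hx.1.2 hadj.symm
  · intro x hx y hy
    simp only [mem_sdiff] at hy
    exact hno x hx y hy.1 hy.2

theorem card_bd_le_rho {M X : Finset V} {a : V} (hX : X ⊆ M) (ha : a ∈ X) (hc : CutConn G X) :
    #(bd G M X) ≤ rho G M a := by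
  unfold rho
  exact le_sup (f := fun X => #(bd G M X)) (by simp [hX, ha, hc])

theorem exists_card_bd_eq_rho {M : Finset V} {a : V} (ha : a ∈ M) :
    ∃ X ⊆ M, a ∈ X ∧ CutConn G X ∧ #(bd G M X) = rho G M a := by
  obtain ⟨X, hX, h⟩ := exists_mem_eq_sup (M.powerset.filter fun X => a ∈ X ∧ CutConn G X)
    ⟨{a}, by simp [ha, cutConn_singleton]⟩ (fun X => #(bd G M X))
  simp only [mem_filter, mem_powerset] at hX
  exact ⟨X, hX.1, hX.2.1, hX.2.2, h.symm⟩

theorem rho_pos {M : Finset V} {a : V} (hM : CutConn G M) (ha : a ∈ M) (h : 2 ≤ #M) :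
    1 ≤ rho G M a := by
  obtain ⟨x, hx, y, hy, hya, hadj⟩ := hM.2 {a} (by simpa using ha) (by simp)
    (fun h' => by rw [← h'] at h; simp at h)
  refine le_trans ?_ (card_bd_le_rho (X := {a}) (by simpa using ha) (by simp) (cutConn_singleton a))
  exact card_pos.2 ⟨y, mem_bd.2 ⟨hy, hya, x, hx, hadj⟩⟩

end Basics

/-! ### Edge bounds for connected sets with a root -/

section Rooted

variable {V : Type*} {G : SimpleGraph V}

open Finset Classical

/-- In a split at `z`, the vertex `z` belongs to the boundary of every connected set on the root
side. -/
theorem rho_split_succ_le {M M' Y : Finset V} {a z : V} (hM : M = M' ∪ insert z Y)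
    (hd : Disjoint M' (insert z Y)) (ha : a ∈ M') (haz : G.Adj a z) :
    rho G M' a + 1 ≤ rho G M a := by
  obtain ⟨X, hX, haX, hc, hr⟩ := exists_card_bd_eq_rho (G := G) ha
  have hz : z ∉ M' := fun h => disjoint_left.1 hd h (by simp)
  refine le_trans ?_ (card_bd_le_rho (M := M) (hX.trans (hM ▸ subset_union_left)) haX hc)
  rw [← hr, ← card_insert_of_notMem (s := bd G M' X) (a := z) (fun h => hz (mem_bd.1 h).1)]
  refine card_le_card fun y hy => ?_
  rcases mem_insert.1 hy with rfl | hy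
  · exact mem_bd.2 ⟨by simp [hM], fun h => hz (hX h), a, haX, haz⟩
  · rw [mem_bd] at hy ⊢
    exact ⟨by simp [hM, hy.1], hy.2⟩

/-- In a split at `z`, connected sets with roots `a` and `z` on the two sides have a connected union,
whose boundary contains both boundaries. -/
theorem rho_split_add_le {M M' Y : Finset V} {a z : V} (hM : M = M' ∪ insert z Y)
    (hd : Disjoint M' (insert z Y)) (ha : a ∈ M') (haz : G.Adj a z) :
    rho G M' a + rho G (insert z Y) z ≤ rho G M a := by
  obtain ⟨X, hX, haX, hc, hr⟩ := exists_card_bd_eq_rho (G := G) ha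
  obtain ⟨X', hX', hzX', hc', hr'⟩ := exists_card_bd_eq_rho (G := G) (mem_insert_self z Y)
  refine le_trans ?_ (card_bd_le_rho (M := M) (X := X ∪ X') (a := a) ?_ (by simp [haX])
    (hc.union_of_adj hc' haX hzX' haz))
  · rw [← hr, ← hr', ← card_union_of_disjoint]
    · refine card_le_card fun y hy => ?_
      rw [mem_union, mem_bd, mem_bd] at hy
      rw [mem_bd, mem_union, hM, mem_union]
      rcases hy with ⟨h1, h2, x, h3, h4⟩ | ⟨h1, h2, x, h3, h4⟩
      · exact ⟨Or.inl h1, fun h => h.elim h2 fun h => disjoint_left.1 hd h1 (hX' h), x,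
          mem_union_left _ h3, h4⟩
      · exact ⟨Or.inr h1, fun h => h.elim (fun h => disjoint_left.1 hd (hX h) h1) h2, x,
          mem_union_right _ h3, h4⟩
    · rw [disjoint_left]
      exact fun y h1 h2 => disjoint_left.1 hd (mem_bd.1 h1).1 (mem_bd.1 h2).1
  · rw [hM]; exact union_subset_union hX hX'

theorem card_nbrs_add_rho_split_le {M M' Y : Finset V} {a z : V} (hM : M = M' ∪ insert z Y)
    (hd : Disjoint M' (insert z Y)) (ha : a ∈ M') (haz : G.Adj a z) :
    #{y ∈ M' | G.Adj z y} + rho G (insert z Y) z ≤ rho G M a + 1 := by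
  obtain ⟨X', hX', hzX', hc', hr'⟩ := exists_card_bd_eq_rho (G := G) (mem_insert_self z Y)
  have key := card_bd_le_rho (M := M) (X := {a} ∪ X') (a := a) ?_ (by simp)
    ((cutConn_singleton a).union_of_adj hc' (by simp) hzX' haz)
  · have h1 : #({y ∈ M' | G.Adj z y}.erase a ∪ bd G (insert z Y) X') ≤ #(bd G M ({a} ∪ X')) := by
      refine card_le_card fun y hy => ?_
      rw [mem_union, mem_bd, mem_erase, mem_filter] at hy
      rw [mem_bd, mem_union, hM, mem_union, mem_singleton]
      rcases hy with ⟨h1, h2, h3⟩ | ⟨h1, h2, x, h3, h4⟩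
      · exact ⟨Or.inl h2, fun h => h.elim h1 fun h => disjoint_left.1 hd h2 (hX' h), z,
          mem_union_right _ hzX', h3⟩
      · exact ⟨Or.inr h1, fun h => h.elim (fun h => disjoint_left.1 hd (h ▸ ha) h1) h2, x,
          mem_union_right _ h3, h4⟩
    rw [card_union_of_disjoint, card_erase_of_mem (by simp [ha, haz.symm])] at h1
    · omega
    · rw [disjoint_left]
      intro y h1 h2
      rw [mem_erase, mem_filter] at h1
      exact disjoint_left.1 hd h1.2.1 (mem_bd.1 h2).1
  · rw [hM]; exact union_subset_union (by simpa using ha) hX'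

theorem rooted_bound_arith {A B D ρ : ℕ} (h1 : A + 1 ≤ ρ) (h2 : A + B ≤ ρ) (h3 : D + B ≤ ρ + 1)
    (h4 : A = 0 → D ≤ 1) :
    (A * (A + 1) - 2) + (B * (B + 1) - 2) + 2 * D ≤ ρ * (ρ + 1) - 2 + 2 := by
  have hρ : 2 ≤ ρ * (ρ + 1) := by nlinarith
  rcases Nat.eq_zero_or_pos A with rfl | hA
  · have := h4 rfl
    rcases Nat.eq_zero_or_pos B with rfl | hB
    · simp; omega
    · have : B * (B + 1) ≤ ρ * (ρ + 1) := Nat.mul_le_mul (by omega) (by omega)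
      simp; omega
  · have hA2 : 2 ≤ A * (A + 1) := by nlinarith
    rcases Nat.eq_zero_or_pos B with rfl | hB
    · obtain ⟨k, rfl⟩ := Nat.exists_eq_add_of_le h1
      zify [hρ, hA2]
      zify at h3
      simp only [zero_mul, Nat.zero_sub, Nat.cast_zero]
      nlinarith
    · have hB2 : 2 ≤ B * (B + 1) := by nlinarith
      obtain ⟨k, rfl⟩ := Nat.exists_eq_add_of_le h2
      zify [hρ, hA2, hB2]
      zify at h3
      nlinarith [mul_nonneg (Int.natCast_nonneg A) (Int.natCast_nonneg k),
        mul_nonneg (Int.natCast_nonneg B) (Int.natCast_nonneg k),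
        mul_nonneg (Int.natCast_nonneg A) (sub_nonneg.2 (Nat.one_le_cast (α := ℤ).2 hB))]

/-- Edge bound for a connected set with a root: if every connected subset that contains the root `a`
has boundary of size at most `ρ`, then there are at most `#M - 1 + (ρ + 1).choose 2 - 1` edges inside
`M` (and `0` edges if `ρ = 0`). Deleting a neighbour `z` of the root lowers `ρ`, as `z` was in every
boundary; the part that only `z` connects to the root is bounded separately, with root `z`. -/
theorem CutConn.ec_self_le {M : Finset V} (hM : CutConn G M) {a : V} (ha : a ∈ M) :
    ec G M M + 2 ≤ 2 * #M + (rho G M a * (rho G M a + 1) - 2) := by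
  induction hn : #M using Nat.strong_induction_on generalizing M a with
  | _ n ih =>
  by_cases hMa : M = {a}
  · subst hMa
    simp only [card_singleton] at hn
    rw [ec_singleton_self]; omega
  obtain ⟨a', ha', z, hz, hza, haz⟩ := hM.2 {a} (by simpa using ha) (by simp) (Ne.symm hMa)
  rw [mem_singleton] at ha' hza
  subst ha'
  obtain ⟨M', Y, hMe, hd, hzY, haM', hcM', hcY, hno⟩ := hM.exists_split ha hz (Ne.symm hza)
  have hcard : #M = #M' + (#Y + 1) := by
    rw [hMe, card_union_of_disjoint hd, card_insert_of_notMem hzY]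
  have hY1 : #(insert z Y) = #Y + 1 := card_insert_of_notMem hzY
  have hM'pos : 0 < #M' := card_pos.2 ⟨_, haM'⟩
  have i1 := ih _ (by omega) hcM' haM' rfl
  have i2 := ih _ (by omega) hcY (mem_insert_self z Y) rfl
  have e1 : ec G M M = ec G M' M' + ec G (insert z Y) (insert z Y)
      + 2 * #{y ∈ M' | G.Adj z y} := by
    rw [hMe, ec_union_self hd, insert_eq, ec_union_right (A := M') (by simpa using hzY),
      ec_comm M' {z}, ec_singleton_left, ec_eq_zero hno, add_zero]
  have := rooted_bound_arith (rho_split_succ_le hMe hd haM' haz) (rho_split_add_le hMe hd haM' haz)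
    (card_nbrs_add_rho_split_le hMe hd haM' haz) (fun h0 => by
      by_contra hD
      have : #{y ∈ M' | G.Adj z y} ≤ #M' := card_filter_le _ _
      have := rho_pos hcM' haM' (by omega)
      omega)
  omega

theorem far_bound_arith {r s b : ℕ} (h : s + b ≤ r + 1) (hb : 1 ≤ b) :
    (s + 2) * (s + 1) + b * (b + 1) ≤ (r + 2) * (r + 1) + 4 := by
  obtain ⟨b, rfl⟩ := Nat.exists_eq_add_of_le hb
  have : s + b ≤ r := by omega
  have h2 : (s + b + 2) * (s + b + 1) ≤ (r + 2) * (r + 1) :=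
    Nat.mul_le_mul (by omega) (by omega)
  nlinarith

/-- Edge bound beyond the neighbourhood of the root: if `v` has degree `β` in `M` and connected
subsets that contain `v` have boundary of size at most `β + r`, then the non-neighbours of `v`
together with any one neighbour `u` span few edges. The other neighbours of `v` are deleted one by
one, and `CutConn.ec_self_le` is applied to the parts that this cuts off and to the part left with
root `u`. -/
theorem CutConn.ec_far_le {M : Finset V} (hM : CutConn G M) {v u : V} (hv : v ∈ M) (hu : u ∈ M)
    (hvu : G.Adj v u) {r : ℕ} (hr : rho G M v ≤ #{y ∈ M | G.Adj v y} + r) {W : Finset V}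
    (hW : W = {w ∈ M | w ≠ v ∧ ¬ G.Adj v w}) :
    ec G (insert u W) (insert u W) + 2 ≤ 2 * #W + (r + 2) * (r + 1) := by
  induction hn : #M using Nat.strong_induction_on generalizing M r W with
  | _ n ih =>
  have huW : u ∉ W := by simp [hW, hvu]
  by_cases hz : ∃ z ∈ M, z ≠ u ∧ G.Adj v z
  · obtain ⟨z, hz, hzu, hvz⟩ := hz
    obtain ⟨M', Y, hMe, hd, hzY, hvM', hcM', hcY, hno⟩ := hM.exists_split hv hz hvz.ne
    have hcard : #M = #M' + (#Y + 1) := by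
      rw [hMe, card_union_of_disjoint hd, card_insert_of_notMem hzY]
    have hzM' : z ∉ M' := fun h => disjoint_left.1 hd h (by simp)
    have huM' : u ∈ M' := by
      rw [hMe, mem_union, mem_insert] at hu
      rcases hu with h | h | h
      · exact h
      · exact absurd h.symm hzu
      · exact absurd hvu (hno v hvM' u h)
    have hdeg : #{y ∈ M | G.Adj v y} = #{y ∈ M' | G.Adj v y} + 1 := by
      rw [← card_insert_of_notMem (a := z) (by simp [hzM'])]
      congr 1; ext y
      simp only [mem_filter, mem_insert, hMe, mem_union]
      constructor
      · rintro ⟨h | h | h, h'⟩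
        · exact Or.inr ⟨h, h'⟩
        · exact Or.inl h
        · exact absurd h' (hno v hvM' y h)
      · rintro (rfl | h)
        · exact ⟨by simp, hvz⟩
        · exact ⟨Or.inl h.1, h.2⟩
    have hs1 := rho_split_succ_le hMe hd hvM' hvz
    have hs2 := rho_split_add_le hMe hd hvM' hvz
    have hYM' : Disjoint M' Y := hd.mono_right (subset_insert _ _)
    obtain ⟨W', hW'⟩ : ∃ W', W' = {w ∈ M' | w ≠ v ∧ ¬ G.Adj v w} := ⟨_, rfl⟩
    have hWe : W = W' ∪ Y := by
      ext w
      simp only [hW, hW', hMe, mem_filter, mem_union, mem_insert]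
      constructor
      · rintro ⟨h | rfl | h, h2, h3⟩
        · exact Or.inl ⟨h, h2, h3⟩
        · exact absurd hvz h3
        · exact Or.inr h
      · rintro (h | h)
        · exact ⟨Or.inl h.1, h.2⟩
        · exact ⟨Or.inr (Or.inr h), fun e => disjoint_left.1 hYM' hvM' (e ▸ h), hno v hvM' w h⟩
    have hW'M' : insert u W' ⊆ M' := insert_subset huM' (by rw [hW']; exact filter_subset _ _)
    have hdW : Disjoint (insert u W') Y := hYM'.mono_left hW'M'
    have e1 : ec G (insert u W) (insert u W) = ec G (insert u W') (insert u W') + ec G Y Y := by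
      rw [hWe, ← insert_union, ec_union_self hdW,
        ec_eq_zero fun x hx y hy => hno x (hW'M' hx) y hy]; ring
    have hcW : #W = #W' + #Y := by
      rw [hWe, card_union_of_disjoint (hdW.mono_left (subset_insert _ _))]
    have hdeg' : #{y ∈ M' | G.Adj v y} ≤ rho G M' v := by
      refine le_trans (card_le_card fun y hy => ?_) (card_bd_le_rho (X := {v}) (by simpa using hvM')
        (by simp) (cutConn_singleton v))
      rw [mem_filter] at hy
      exact mem_bd.2 ⟨hy.1, by simpa using hy.2.ne', v, by simp, hy.2⟩
    rcases Y.eq_empty_or_nonempty with rfl | hY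
    · have := ih _ (by omega) hcM' hvM' huM' (r := r) (by omega) hW' rfl
      simp only [e1, hcW, card_empty]
      rw [ec_eq_zero (A := ∅) (by simp)]
      omega
    · have i1 := ih _ (by omega) hcM' hvM' huM' (r := rho G M' v - #{y ∈ M' | G.Adj v y})
        (by omega) hW' rfl
      have i2 := hcY.ec_self_le (mem_insert_self z Y)
      have hYpos : 0 < #Y := card_pos.2 hY
      rw [card_insert_of_notMem hzY] at i2
      have hρY := rho_pos hcY (mem_insert_self z Y) (by rw [card_insert_of_notMem hzY]; omega)
      have e2 : ec G (insert z Y) (insert z Y) = ec G Y Y + 2 * ec G {z} Y := by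
        rw [insert_eq, ec_union_self (by simpa using hzY), ec_singleton_self]; ring
      have e3 : 1 ≤ ec G {z} Y := by
        obtain ⟨x, hx, y, hy, hyz, hadj⟩ := hcY.2 {z} (by simp) (by simp) (fun h => by
          have := congrArg card h
          rw [card_insert_of_notMem hzY, card_singleton] at this; omega)
        rw [mem_singleton] at hx hyz
        subst hx
        rw [ec_singleton_left]
        exact card_pos.2 ⟨y, by simp only [mem_filter]; exact ⟨by simpa [hyz] using hy, hadj⟩⟩
      have ar := far_bound_arith (r := r) (s := rho G M' v - #{y ∈ M' | G.Adj v y})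
        (b := rho G (insert z Y) z) (by omega) hρY
      have hb2 : 2 ≤ rho G (insert z Y) z * (rho G (insert z Y) z + 1) := by nlinarith
      omega
  · push Not at hz
    obtain ⟨M', Y, hMe, hd, huY, hvM', hcM', hcY, hno⟩ := hM.exists_split hv hu hvu.ne
    have huM' : u ∉ M' := fun h => disjoint_left.1 hd h (by simp)
    have hM' : M' = {v} := by
      by_contra hne
      obtain ⟨x, hx, y, hy, hyz, hadj⟩ := hcM'.2 {v} (by simpa using hvM') (by simp) (Ne.symm hne)
      rw [mem_singleton] at hx
      subst hx
      exact hz y (by simp [hMe, hy]) (fun e => huM' (e ▸ hy)) hadj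
    have hWe : W = Y := by
      ext w
      simp only [hW, hMe, hM', mem_filter, mem_union, mem_insert, mem_singleton]
      constructor
      · rintro ⟨h | rfl | h, h2, h3⟩
        · exact absurd h h2
        · exact absurd hvu h3
        · exact h
      · intro h
        exact ⟨Or.inr (Or.inr h), fun e => disjoint_left.1 hd hvM' (by simp [← e, h]),
          hno v hvM' w h⟩
    have hdeg : #{y ∈ M | G.Adj v y} = 1 := by
      rw [card_eq_one]
      refine ⟨u, ?_⟩
      ext y; simp only [mem_filter, mem_singleton]
      constructor
      · rintro ⟨h1, h2⟩
        by_contra h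
        exact hz y h1 h h2
      · rintro rfl; exact ⟨hu, hvu⟩
    have hs2 := rho_split_add_le hMe hd hvM' hvu
    have i2 := hcY.ec_self_le (mem_insert_self u Y)
    rw [card_insert_of_notMem huY] at i2
    subst hWe
    have h2 : rho G (insert u W) u * (rho G (insert u W) u + 1) ≤ (r + 1) * (r + 2) :=
      Nat.mul_le_mul (by omega) (by omega)
    have h3 : 2 ≤ (r + 1) * (r + 2) := by nlinarith
    rw [mul_comm (r + 2)]
    omega

end Rooted

/-! ### Graphs in which all boundaries are small have few edges -/

/-- The graph of the non-adjacent pairs of distinct vertices inside `N`. -/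
def nonEdges {V : Type*} (G : SimpleGraph V) (N : Finset V) : SimpleGraph V where
  Adj x y := x ≠ y ∧ ¬ G.Adj x y ∧ x ∈ N ∧ y ∈ N
  symm := ⟨fun _ _ h => ⟨h.1.symm, fun h' => h.2.1 h'.symm, h.2.2.2, h.2.2.1⟩⟩
  loopless := ⟨fun _ h => h.1 rfl⟩

theorem nonEdges_adj {V : Type*} {G : SimpleGraph V} {N : Finset V} {x y : V} :
    (nonEdges G N).Adj x y ↔ x ≠ y ∧ ¬ G.Adj x y ∧ x ∈ N ∧ y ∈ N := Iff.rfl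

section EdgeCount

variable {V : Type*} {G : SimpleGraph V}

open Finset Classical

theorem ec_mono {A B A' B' : Finset V} (hA : A ⊆ A') (hB : B ⊆ B') : ec G A B ≤ ec G A' B' := by
  unfold ec
  exact (sum_le_sum fun x _ => card_le_card (filter_subset_filter _ hB)).trans
    (sum_le_sum_of_subset hA)

theorem ec_univ [Fintype V] : ec G univ univ = 2 * G.edgeSet.ncard := by
  rw [← G.coe_edgeFinset, Set.ncard_coe_finset, ← G.sum_degrees_eq_twice_card_edges]
  unfold ec
  refine sum_congr rfl fun x _ => ?_
  rw [← G.card_neighborFinset_eq_degree]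
  congr 1; ext y; simp

theorem ec_nonEdges_add [Fintype V] (N : Finset V) :
    ec (nonEdges G N) univ univ + ec G N N = #N * (#N - 1) := by
  have h0 : ec (nonEdges G N) univ univ = ec (nonEdges G N) N N := by
    unfold ec
    rw [← sum_subset (subset_univ N)]
    · refine sum_congr rfl fun x _ => ?_
      congr 1; ext y; simp only [mem_filter, nonEdges_adj, mem_univ, true_and]; tauto
    · intro x _ hx
      rw [card_eq_zero, filter_eq_empty_iff]
      exact fun y _ h => hx h.2.2.1
  rw [h0]
  unfold ec
  rw [← sum_add_distrib, sum_const_nat]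
  intro x hx
  rw [← card_erase_of_mem hx, ← card_union_of_disjoint]
  · congr 1; ext y
    simp only [mem_union, mem_filter, mem_erase, nonEdges_adj]
    constructor
    · rintro (h | h)
      · exact ⟨h.2.1.symm, h.1⟩
      · exact ⟨h.2.ne', h.1⟩
    · intro h
      by_cases hxy : G.Adj x y
      · exact Or.inr ⟨h.2, hxy⟩
      · exact Or.inl ⟨h.2, Ne.symm h.1, hxy, hx, h.2⟩
  · rw [disjoint_left]
    intro y h1 h2
    rw [mem_filter] at h1 h2
    exact h1.2.2.1 h2.2

theorem card_le_ncard_edgeSet_add_one [Finite V] {P : Finset V}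
    (hP : ∀ x ∈ P, ∀ y ∈ P, G.Reachable x y) : #P ≤ G.edgeSet.ncard + 1 := by
  rcases P.eq_empty_or_nonempty with rfl | ⟨x, hx⟩
  · simp
  have hc := (G.connectedComponentMk x).connected_toSimpleGraph
  have h1 := hc.card_vert_le_card_edgeSet_add_one
  have h2 : #P ≤ Nat.card (G.connectedComponentMk x) := by
    rw [← Set.ncard_coe_finset, ← Nat.card_coe_set_eq]
    refine Nat.card_le_card_of_injective
      (fun p : (P : Set V) => (⟨p.1, ?_⟩ : (G.connectedComponentMk x).supp)) ?_
    · rw [SimpleGraph.ConnectedComponent.mem_supp_iff, SimpleGraph.ConnectedComponent.eq]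
      exact hP _ p.2 _ hx
    · intro p q h; exact Subtype.ext (Subtype.mk.inj h)
  have h3 : Nat.card (G.connectedComponentMk x).toSimpleGraph.edgeSet ≤ G.edgeSet.ncard := by
    rw [← Nat.card_coe_set_eq]
    exact Nat.card_le_card_of_injective _
      (SimpleGraph.Embedding.induce (G := G) (G.connectedComponentMk x).supp).mapEdgeSet.injective
  omega

end EdgeCount

section ManyEdges

variable {V : Type*} [Fintype V] {G : SimpleGraph V}

open Finset Classical

/-- If all boundaries of connected sets have at most `t` vertices and `v` has `t` neighbours, then
at least `p - 1` pairs of neighbours of `v` are non-adjacent, where `p` is the number of neighbours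
of `v` that have a neighbour at distance two from `v`. For two such vertices `x`, `y` that see
different far vertices, the boundary of `{x, y}` would be too large if they were adjacent and had no
common non-neighbour, so they lie in one component of the graph of non-adjacent pairs. -/
theorem card_far_nbrs_le (hG : CutConn G univ) {t : ℕ}
    (hL : ∀ X, CutConn G X → #(bd G univ X) ≤ t) {v : V} {N W U : Finset V}
    (hN : N = univ.filter fun y => G.Adj v y)
    (hW : W = univ.filter fun w => w ≠ v ∧ ¬ G.Adj v w) (hNt : #N = t) (hW2 : 2 ≤ #W)
    (hU : U = {u ∈ N | ∃ w ∈ W, G.Adj u w}) :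
    2 * #U ≤ ec (nonEdges G N) univ univ + 2 := by
  have memN : ∀ y, y ∈ N ↔ G.Adj v y := by simp [hN]
  have memW : ∀ y, y ∈ W ↔ y ≠ v ∧ ¬ G.Adj v y := by simp [hW]
  have memU : ∀ y, y ∈ U ↔ y ∈ N ∧ ∃ w ∈ W, G.Adj y w := by simp [hU]
  have hvN : v ∉ N := by simp [memN]
  have hNW : ∀ y ∈ N, y ∉ W := fun y hy h => ((memW y).1 h).2 ((memN y).1 hy)
  have hvW : v ∉ W := by simp [memW]
  rcases U.eq_empty_or_nonempty with hU0 | ⟨u₀, hu₀⟩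
  · simp [hU0]
  obtain ⟨hu₀N, s, hs, hus⟩ := (memU _).1 hu₀
  by_cases hsingle : ∀ u ∈ U, ∀ w ∈ W, G.Adj u w → w = s
  · -- Only one far vertex `s` is seen from `N`, and it has a neighbour `s'` beyond. The boundary of
    -- `{u, s}` for `u ∈ U` then gives a non-neighbour of `u` in `N \ U`.
    obtain ⟨s', hs', y, -, hy, hadj⟩ := hG.2 (W.erase s) (subset_univ _)
      (card_pos.1 (by rw [card_erase_of_mem hs]; omega)) (fun h => hvW (mem_of_mem_erase
        (h ▸ mem_univ v)))
    rw [mem_erase] at hs' hy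
    have hys : y = s := by
      by_contra hne
      have hyW : y ∉ W := fun h => hy ⟨hne, h⟩
      rw [memW] at hyW
      by_cases hyv : y = v
      · subst hyv; exact ((memW _).1 hs'.2).2 hadj.symm
      · have hyN : y ∈ N := (memN y).2 (by tauto)
        exact hs'.1 (hsingle y ((memU y).2 ⟨hyN, s', hs'.2, hadj.symm⟩) s' hs'.2 hadj.symm)
    subst hys
    have hex : ∀ u ∈ U, ∃ y ∈ N \ U, (nonEdges G N).Adj u y := by
      intro u hu
      obtain ⟨huN, w, hw, huw⟩ := (memU u).1 hu
      have : w = y := hsingle u hu w hw huw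
      subst this
      by_contra hcon
      push Not at hcon
      have hall : ∀ z ∈ N, z ≠ u → z ∈ U ∨ G.Adj u z := by
        intro z hz hzu
        by_contra h
        push Not at h
        exact hcon z (by simp [hz, h.1]) ⟨hzu.symm, h.2, huN, hz⟩
      have hb := hL _ (cutConn_pair huw)
      have hsub : insert v (insert s' (N.erase u)) ⊆ bd G univ {u, w} := by
        intro z hz
        rw [mem_insert, mem_insert, mem_erase] at hz
        rw [mem_bd]
        refine ⟨mem_univ _, ?_, ?_⟩
        · rw [mem_insert, mem_singleton]
          rintro (rfl | rfl)
          · rcases hz with rfl | rfl | h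
            · exact hvN huN
            · exact hNW _ huN hs'.2
            · exact h.1 rfl
          · rcases hz with rfl | rfl | h
            · exact hvW hw
            · exact hs'.1 rfl
            · exact hNW _ h.2 hw
        · rcases hz with rfl | rfl | h
          · exact ⟨u, by simp, ((memN u).1 huN).symm⟩
          · exact ⟨w, by simp, hadj.symm⟩
          · rcases hall z h.2 h.1 with h' | h'
            · obtain ⟨-, w', hw', hzw'⟩ := (memU z).1 h'
              exact ⟨w, by simp, by rw [← hsingle z h' w' hw' hzw']; exact hzw'.symm⟩
            · exact ⟨u, by simp, h'⟩
      have hc := card_le_card hsub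
      rw [card_insert_of_notMem, card_insert_of_notMem, card_erase_of_mem huN] at hc
      · have : 0 < #N := card_pos.2 ⟨u, huN⟩
        omega
      · exact fun h => hNW _ (mem_of_mem_erase h) hs'.2
      · rw [mem_insert]
        rintro (h | h)
        · exact hvW (h ▸ hs'.2)
        · exact hvN (mem_of_mem_erase h)
    have h1 : #U ≤ ec (nonEdges G N) U (N \ U) := by
      unfold ec
      rw [card_eq_sum_ones]
      refine sum_le_sum fun u hu => ?_
      obtain ⟨y, hy, hadj⟩ := hex u hu
      exact card_pos.2 ⟨y, mem_filter.2 ⟨hy, hadj⟩⟩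
    have h2 := ec_mono (G := nonEdges G N) (subset_univ (U ∪ N \ U)) (subset_univ (U ∪ N \ U))
    rw [ec_union_self disjoint_sdiff] at h2
    omega
  · push Not at hsingle
    obtain ⟨u₁, hu₁, s₁, hs₁, hus₁, hne⟩ := hsingle
    have key : ∀ x ∈ U, ∀ y ∈ U, ∀ w ∈ W, ∀ w' ∈ W, G.Adj x w → G.Adj y w' → w ≠ w' →
        (nonEdges G N).Reachable x y := by
      intro x hx y hy w hw w' hw' hxw hyw' hww'
      have hxN := ((memU x).1 hx).1
      have hyN := ((memU y).1 hy).1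
      by_cases hxy : x = y
      · subst hxy; rfl
      by_cases hadj : G.Adj x y
      · suffices ∃ z ∈ N, (z ≠ x ∧ ¬ G.Adj x z) ∧ (z ≠ y ∧ ¬ G.Adj y z) by
          obtain ⟨z, hz, h1, h2⟩ := this
          have a1 : (nonEdges G N).Adj x z := ⟨h1.1.symm, h1.2, hxN, hz⟩
          have a2 : (nonEdges G N).Adj z y := ⟨h2.1, fun h => h2.2 h.symm, hz, hyN⟩
          exact a1.reachable.trans a2.reachable
        by_contra hcon
        push Not at hcon
        have hb := hL _ (cutConn_pair hadj)
        have hsub : insert v (insert w (insert w' ((N.erase x).erase y))) ⊆ bd G univ {x, y} := by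
          intro z hz
          rw [mem_insert, mem_insert, mem_insert, mem_erase, mem_erase] at hz
          rw [mem_bd]
          refine ⟨mem_univ _, ?_, ?_⟩
          · rw [mem_insert, mem_singleton]
            intro hzxy
            have hzN : z ∈ N := by rcases hzxy with rfl | rfl <;> assumption
            rcases hz with rfl | rfl | rfl | h
            · exact hvN hzN
            · exact hNW _ hzN hw
            · exact hNW _ hzN hw'
            · tauto
          · rcases hz with rfl | rfl | rfl | h
            · exact ⟨x, by simp, ((memN x).1 hxN).symm⟩
            · exact ⟨x, by simp, hxw⟩
            · exact ⟨y, by simp, hyw'⟩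
            · by_cases hxz : G.Adj x z
              · exact ⟨x, by simp, hxz⟩
              · exact ⟨y, by simp, hcon z h.2.2 ⟨h.2.1, hxz⟩ h.1⟩
        have hc := card_le_card hsub
        rw [card_insert_of_notMem, card_insert_of_notMem, card_insert_of_notMem,
          card_erase_of_mem (mem_erase.2 ⟨Ne.symm hxy, hyN⟩), card_erase_of_mem hxN] at hc
        · have : 2 ≤ #N := by
            rw [← card_pair hxy]
            exact card_le_card (by simp [insert_subset_iff, hxN, hyN])
          omega
        · exact fun h => hNW _ (mem_of_mem_erase (mem_of_mem_erase h)) hw'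
        · rw [mem_insert]
          rintro (h | h)
          · exact hww' h
          · exact hNW _ (mem_of_mem_erase (mem_of_mem_erase h)) hw
        · rw [mem_insert, mem_insert]
          rintro (h | h | h)
          · exact hvW (h ▸ hw)
          · exact hvW (h ▸ hw')
          · exact hvN (mem_of_mem_erase (mem_of_mem_erase h))
      · exact (show (nonEdges G N).Adj x y from ⟨hxy, hadj, hxN, hyN⟩).reachable
    have := card_le_ncard_edgeSet_add_one (G := nonEdges G N) (P := U) (fun x hx y hy => by
      obtain ⟨-, w, hw, hxw⟩ := (memU x).1 hx
      obtain ⟨-, w', hw', hyw'⟩ := (memU y).1 hy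
      by_cases hww' : w = w'
      · subst hww'
        by_cases hws : w = s
        · subst hws
          exact (key x hx u₁ hu₁ w hw s₁ hs₁ hxw hus₁ hne.symm).trans
            (key u₁ hu₁ y hy s₁ hs₁ w hw hus₁ hyw' hne)
        · exact (key x hx u₀ hu₀ w hw s hs hxw hus hws).trans
            (key u₀ hu₀ y hy s hs w hw hus hyw' (Ne.symm hws))
      · exact key x hx y hy w hw w' hw' hxw hyw' hww')
    rw [ec_univ]
    omega

theorem many_edges_arith {d r m e n w eW eN t : ℕ} (ht : t = d + r) (hm : m ≤ r + 1) (hd : 2 ≤ d)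
    (hr : 1 ≤ r) (hn : n = w + d + 1) (he : e ≤ (d + 1) * d + eN + eW) (heN : eN ≤ d * m)
    (heW : eW + 2 * m + 2 ≤ 2 * w + (r + 2) * (r + 1)) : e + 2 ≤ 2 * n + t * (t - 1) := by
  obtain ⟨j, hj⟩ := Nat.exists_eq_add_of_le hm
  obtain ⟨d, rfl⟩ := Nat.exists_eq_add_of_le hd
  obtain ⟨r, rfl⟩ := Nat.exists_eq_add_of_le hr
  have h1 : t - 1 = d + r + 2 := by omega
  rw [h1, ht, hn]
  obtain rfl : m = r + 2 - j := by omega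
  zify [show j ≤ r + 2 by omega] at *
  nlinarith [mul_nonneg (Int.natCast_nonneg d) (Int.natCast_nonneg r),
    mul_nonneg (Int.natCast_nonneg d) (Int.natCast_nonneg j)]

/-- A connected graph on `n ≥ t + 3` vertices in which every connected set has at most `t` boundary
vertices has at most `n - 1 + t.choose 2` edges. -/
theorem ec_univ_le_of_card_bd_le (hG : CutConn G univ) {t : ℕ}
    (hL : ∀ X, CutConn G X → #(bd G univ X) ≤ t) (hn : t + 3 ≤ Fintype.card V) :
    ec G univ univ + 2 ≤ 2 * Fintype.card V + t * (t - 1) := by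
  obtain ⟨v, -, hmax⟩ := exists_max_image univ (fun x => #{y | G.Adj x y}) hG.1
  obtain ⟨N, hN⟩ : ∃ N : Finset V, N = univ.filter fun y => G.Adj v y := ⟨_, rfl⟩
  obtain ⟨W, hW⟩ : ∃ W : Finset V, W = univ.filter fun w => w ≠ v ∧ ¬ G.Adj v w := ⟨_, rfl⟩
  have memN : ∀ y, y ∈ N ↔ G.Adj v y := by simp [hN]
  have memW : ∀ y, y ∈ W ↔ y ≠ v ∧ ¬ G.Adj v y := by simp [hW]
  have hvN : v ∉ N := by simp [memN]
  have hNW : ∀ y ∈ N, y ∉ W := fun y hy h => ((memW y).1 h).2 ((memN y).1 hy)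
  have hvW : v ∉ W := by simp [memW]
  have hmax' : ∀ x, #{y | G.Adj x y} ≤ #N := fun x => by rw [hN]; exact hmax x (mem_univ x)
  have huniv : (univ : Finset V) = insert v N ∪ W := by
    ext y; simp only [mem_univ, mem_union, mem_insert, memN, memW, true_iff]; tauto
  have hdNW : Disjoint (insert v N) W := by
    rw [disjoint_left]; intro y hy
    rcases mem_insert.1 hy with rfl | hy
    · exact hvW
    · exact hNW y hy
  have hcard : Fintype.card V = #W + #N + 1 := by
    rw [← card_univ, huniv, card_union_of_disjoint hdNW, card_insert_of_notMem hvN]; ring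
  have hNt : #N ≤ t := by
    refine le_trans (card_le_card fun y hy => ?_) (hL {v} (cutConn_singleton v))
    rw [memN] at hy
    exact mem_bd.2 ⟨mem_univ _, by simpa using hy.ne', v, by simp, hy⟩
  -- A connected graph with at least three vertices has a vertex of degree two.
  have hN2 : 2 ≤ #N := by
    by_contra hlt
    have hsub : insert v N ≠ univ := fun h => by
      have := congrArg card h
      rw [card_insert_of_notMem hvN, card_univ] at this; omega
    obtain ⟨x, hx, y, -, hy, hadj⟩ := hG.2 (insert v N) (subset_univ _) (by simp) hsub
    rw [mem_insert] at hx hy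
    push Not at hy
    rcases hx with rfl | hx
    · exact hy.2 ((memN y).2 hadj)
    · have h2 : #({v, y} : Finset V) ≤ #{z | G.Adj x z} := by
        refine card_le_card fun z hz => ?_
        rw [mem_insert, mem_singleton] at hz
        rw [mem_filter]
        rcases hz with rfl | rfl
        · exact ⟨mem_univ _, ((memN x).1 hx).symm⟩
        · exact ⟨mem_univ _, hadj⟩
      rw [card_pair hy.1.symm] at h2
      have := hmax' x
      omega
  obtain ⟨u, hu, humax⟩ := exists_max_image N (fun x => #{y ∈ W | G.Adj x y})
    (card_pos.1 (by omega))
  have hvu := (memN u).1 hu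
  have hm : ∀ x ∈ N, #N + #{y ∈ W | G.Adj x y} ≤ t + 1 := by
    intro x hx
    have hb := hL _ (cutConn_pair ((memN x).1 hx))
    have hsub : N.erase x ∪ {y ∈ W | G.Adj x y} ⊆ bd G univ {v, x} := by
      intro z hz
      rw [mem_union, mem_erase, mem_filter] at hz
      rw [mem_bd, mem_insert, mem_singleton]
      refine ⟨mem_univ _, ?_, ?_⟩
      · rintro (rfl | rfl)
        · exact hz.elim (fun h => hvN h.2) fun h => hvW h.1
        · exact hz.elim (fun h => h.1 rfl) fun h => hNW _ hx h.1
      · rcases hz with h | h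
        · exact ⟨v, by simp, (memN z).1 h.2⟩
        · exact ⟨x, by simp, h.2⟩
    have hc := card_le_card hsub
    rw [card_union_of_disjoint, card_erase_of_mem hx] at hc
    · omega
    · rw [disjoint_left]
      exact fun y h1 h2 => hNW y (mem_of_mem_erase h1) (mem_filter.1 h2).1
  obtain ⟨r, hr⟩ := Nat.exists_eq_add_of_le hNt
  have hρ : rho G univ v ≤ #{y ∈ univ | G.Adj v y} + r := by
    rw [← hN, ← hr]
    obtain ⟨X, -, -, hc, hX⟩ := exists_card_bd_eq_rho (G := G) (mem_univ v)
    rw [← hX]; exact hL X hc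
  have hfar := hG.ec_far_le (mem_univ v) (mem_univ u) hvu hρ (W := W) hW
  have huW : u ∉ W := hNW u hu
  have hfar' : ec G (insert u W) (insert u W) = ec G W W + 2 * #{y ∈ W | G.Adj u y} := by
    rw [insert_eq, ec_union_self (by simpa using huW), ec_singleton_self, ec_singleton_left]; ring
  have hNWc : ec G (insert v N) W = ec G N W := by
    rw [insert_eq, ec_union_left (by simpa using hvN), ec_eq_zero (A := {v}), zero_add]
    intro x hx y hy
    rw [mem_singleton] at hx; subst hx
    exact ((memW y).1 hy).2
  rcases Nat.eq_zero_or_pos r with rfl | hr1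
  -- If `v` has `t` neighbours, degrees alone do not suffice, and the edges missing in `N` enter.
  · obtain ⟨U, hU⟩ : ∃ U, U = {u ∈ N | ∃ w ∈ W, G.Adj u w} := ⟨_, rfl⟩
    have hfew := card_far_nbrs_le hG hL hN hW (by omega) (by omega) hU
    have hsum := ec_nonEdges_add (G := G) N
    have hp : ec G N W ≤ #U := by
      unfold ec
      rw [hU, card_filter]
      refine sum_le_sum fun x hx => ?_
      split_ifs with h
      · have := hm x hx; omega
      · push Not at h
        rw [Nat.le_zero, card_eq_zero, filter_eq_empty_iff]
        exact h
    have e1 : ec G (insert v N) (insert v N) = ec G N N + 2 * #N := by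
      rw [insert_eq, ec_union_self (by simpa using hvN), ec_singleton_self, ec_singleton_left,
        filter_true_of_mem fun y hy => (memN y).1 hy]; ring
    rw [huniv, ec_union_self hdNW, e1, hNWc, hcard]
    rw [show t = #N by omega]
    rcases Nat.eq_zero_or_pos #{y ∈ W | G.Adj u y} with h0 | h0
    · have : ec G N W = 0 := by
        unfold ec
        exact sum_eq_zero fun x hx => Nat.le_zero.1 (h0 ▸ humax x hx)
      have : ec G W W + 2 ≤ 2 * #W + 2 := by omega
      omega
    · omega
  · refine many_edges_arith (d := #N) (r := r) (m := #{y ∈ W | G.Adj u y}) (w := #W)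
      (eW := ec G W W) (eN := ec G N W) hr (by have := hm u hu; omega) hN2 hr1 hcard ?_ ?_
      (by omega)
    · have h1 : ec G (insert v N) univ ≤ (#N + 1) * #N := by
        unfold ec
        rw [← card_insert_of_notMem hvN, ← smul_eq_mul]
        exact sum_le_card_nsmul _ _ _ fun x _ => hmax' x
      have h2 : ec G univ univ = ec G (insert v N) univ + ec G W univ := by
        rw [← ec_union_left hdNW, ← huniv]
      have h3 : ec G W univ = ec G N W + ec G W W := by
        rw [← hNWc, ec_comm _ W, ← ec_union_right hdNW, ← huniv]
      omega
    · unfold ec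
      rw [← smul_eq_mul]
      exact sum_le_card_nsmul _ _ _ humax

end ManyEdges

/-! ### MVC-colourings with many colours -/

section Colorings

variable {V : Type*} {G : SimpleGraph V}

open Finset Classical

theorem SimpleGraph.Connected.cutConn_univ [Fintype V] (hG : G.Connected) : CutConn G univ := by
  have := hG.nonempty
  refine ⟨univ_nonempty, fun A _ hne hA => ?_⟩
  obtain ⟨x, hx⟩ := hne
  obtain ⟨y, hy⟩ : ∃ y, y ∉ A := by
    by_contra h; push Not at h; exact hA (eq_univ_iff_forall.2 h)
  obtain ⟨p⟩ := hG.preconnected x y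
  obtain ⟨d, -, h1, h2⟩ := p.exists_boundary_dart (A : Set V) (by simpa using hx) (by simpa using hy)
  exact ⟨d.fst, by simpa using h1, d.snd, mem_univ _, by simpa using h2, d.adj⟩

theorem CutConn.exists_walk {X : Finset V} (hX : CutConn G X) {u v : V} (hu : u ∈ X) (hv : v ∈ X) :
    ∃ p : G.Walk u v, ∀ w ∈ p.support, w ∈ X := by
  by_contra hcon
  obtain ⟨x, hx, y, hy, hyA, hadj⟩ := hX.2
    (X.filter fun w => ∃ p : G.Walk u w, ∀ z ∈ p.support, z ∈ X) (filter_subset _ _)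
    ⟨u, mem_filter.2 ⟨hu, SimpleGraph.Walk.nil, by simpa using hu⟩⟩
    (fun h => hcon (by rw [← h, mem_filter] at hv; exact hv.2))
  obtain ⟨-, p, hp⟩ := mem_filter.1 hx
  refine hyA (mem_filter.2 ⟨hy, p.concat hadj, fun z hz => ?_⟩)
  rw [SimpleGraph.Walk.support_concat, List.mem_append,
    List.mem_singleton] at hz
  rcases hz with hz | rfl
  · exact hp z hz
  · exact hy

/-- A connected dominating set in one colour and all other vertices in colours of their own form an
MVC-colouring. -/
theorem card_sdiff_lt_mvc [Fintype V] (hG : G.Connected) {X : Finset V} (hX : CutConn G X)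
    (hdom : ∀ y ∉ X, ∃ x ∈ X, G.Adj x y) : #(univ \ X) + 1 ≤ mvc G := by
  set c : V → ℕ := fun w => if w ∈ X then 0 else (Fintype.equivFin V w).1 + 1 with hc
  have hcX : ∀ w ∈ X, c w = 0 := fun w hw => by simp [hc, hw]
  refine le_trans ?_ ((mvc_isGreatest G hG).2 ⟨c, fun u v => ?_, rfl⟩)
  · rw [← Set.image_univ, ← coe_univ, ← coe_image, Set.ncard_coe_finset]
    have h0 : (0 : ℕ) ∉ (univ \ X).image c := by
      rw [mem_image]
      rintro ⟨w, hw, h⟩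
      rw [mem_sdiff] at hw
      simp [hc, hw.2] at h
    have h1 : #((univ \ X).image c) = #(univ \ X) := by
      refine card_image_of_injOn fun a ha b hb h => ?_
      simp only [coe_sdiff, Set.mem_sdiff, mem_coe] at ha hb
      simp only [hc, ha.2, hb.2, if_false, add_left_inj] at h
      exact (Fintype.equivFin V).injective (Fin.ext h)
    rw [← h1, ← card_insert_of_notMem h0]
    refine card_le_card (insert_subset ?_ (image_subset_image (subset_univ _)))
    obtain ⟨x, hx⟩ := hX.1
    exact mem_image.2 ⟨x, mem_univ x, hcX x hx⟩
  · have near : ∀ u, ∃ x ∈ X, ∃ p : G.Walk u x, ∀ w ∈ p.support, w = u ∨ w ∈ X := by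
      intro u
      by_cases hu : u ∈ X
      · exact ⟨u, hu, SimpleGraph.Walk.nil, by simp⟩
      · obtain ⟨x, hx, hxu⟩ := hdom u hu
        exact ⟨x, hx, hxu.symm.toWalk, by simp [hx]⟩
    obtain ⟨x, hx, p, hp⟩ := near u
    obtain ⟨y, hy, q, hq⟩ := near v
    obtain ⟨r, hr⟩ := hX.exists_walk hx hy
    refine ⟨((p.append r).append q.reverse).bypass, SimpleGraph.Walk.bypass_isPath _, 0,
      fun w hw hwu hwv => hcX w ?_⟩
    have := SimpleGraph.Walk.support_bypass_subset_support _ hw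
    rw [SimpleGraph.Walk.mem_support_append_iff, SimpleGraph.Walk.mem_support_append_iff,
      SimpleGraph.Walk.support_reverse, List.mem_reverse] at this
    rcases this with (h | h) | h
    · exact (hp w h).resolve_left hwu
    · exact hr w h
    · exact (hq w h).resolve_left hwv

theorem card_le_mvc_of_diam_le_two [Fintype V] (hG : G.Connected)
    (h2 : ∀ u v, u ≠ v → ¬ G.Adj u v → ∃ w, G.Adj u w ∧ G.Adj v w) : Fintype.card V ≤ mvc G := by
  refine (mvc_isGreatest G hG).2 ⟨fun w => (Fintype.equivFin V w).1, fun u v => ?_, ?_⟩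
  · by_cases huv : u = v
    · subst huv
      exact ⟨SimpleGraph.Walk.nil, by simp, 0, by simp +contextual⟩
    by_cases hadj : G.Adj u v
    · refine ⟨hadj.toWalk, by simp [huv], 0, fun w hw h1 h2 => ?_⟩
      simp [h1, h2] at hw
    · obtain ⟨z, hz1, hz2⟩ := h2 u v huv hadj
      refine ⟨(hz1.toWalk.append hz2.symm.toWalk).bypass, SimpleGraph.Walk.bypass_isPath _,
        (Fintype.equivFin V z).1, fun w hw h1 h2 => ?_⟩
      have := SimpleGraph.Walk.support_bypass_subset_support _ hw
      simp [h1, h2] at this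
      rw [this]
  · rw [← Set.image_univ, Set.ncard_image_of_injective, Set.ncard_univ, Nat.card_eq_fintype_card]
    exact Fin.val_injective.comp (Fintype.equivFin V).injective

/-- Growing a connected set by boundary vertices until it is dominating never shrinks its
boundary, which in the end is its complement. -/
theorem card_bd_lt_mvc [Fintype V] (hG : G.Connected) {X : Finset V} (hX : CutConn G X) :
    #(bd G univ X) + 1 ≤ mvc G := by
  obtain ⟨Y, hY, hmax⟩ := exists_max_image
    (univ.filter fun Y => CutConn G Y ∧ #(bd G univ X) ≤ #(bd G univ Y)) card
    ⟨X, by simp [hX]⟩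
  simp only [mem_filter, mem_univ, true_and] at hY hmax
  have hdom : ∀ y ∉ Y, y ∈ bd G univ Y := by
    by_contra hcon
    push Not at hcon
    obtain ⟨w, hwY, hwb⟩ := hcon
    obtain ⟨x, hx, y, -, hyA, hadj⟩ := hG.cutConn_univ.2 (Y ∪ bd G univ Y) (subset_univ _)
      (hY.1.1.mono subset_union_left) (fun h => by
        have := mem_univ w
        rw [← h, mem_union] at this; tauto)
    rw [mem_union] at hx hyA
    push Not at hyA
    have hxb : x ∈ bd G univ Y := by
      refine hx.resolve_left fun h => hyA.2 (mem_bd.2 ⟨mem_univ _, hyA.1, x, h, hadj⟩)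
    obtain ⟨-, hxY, z, hz, hzx⟩ := mem_bd.1 hxb
    have hle : #(bd G univ Y) ≤ #(bd G univ (insert x Y)) := by
      have hsub : insert y ((bd G univ Y).erase x) ⊆ bd G univ (insert x Y) := by
        intro t ht
        rw [mem_insert, mem_erase] at ht
        rw [mem_bd, mem_insert]
        rcases ht with rfl | ⟨h1, h2⟩
        · refine ⟨mem_univ _, ?_, x, by simp, hadj⟩
          rintro (h | h)
          · exact hadj.ne' h
          · exact hyA.1 h
        · obtain ⟨-, h3, s, h4, h5⟩ := mem_bd.1 h2
          exact ⟨mem_univ _, by tauto, s, by simp [h4], h5⟩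
      have := card_le_card hsub
      rw [card_insert_of_notMem (fun h => hyA.2 (mem_of_mem_erase h)), card_erase_of_mem hxb] at this
      omega
    have := hmax (insert x Y) ⟨hY.1.insert_of_adj hz hzx, hY.2.trans hle⟩
    rw [card_insert_of_notMem hxY] at this
    omega
  have h1 := card_sdiff_lt_mvc hG hY.1 fun y hy => by
    obtain ⟨-, -, h⟩ := mem_bd.1 (hdom y hy); exact h
  have h2 : #(bd G univ Y) ≤ #(univ \ Y) := card_le_card fun y hy => by
    simp [(mem_bd.1 hy).2.1]
  omega

theorem card_le_mvc_add_one_of_dominating_edge [Fintype V] (hG : G.Connected) {p q : V}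
    (hpq : G.Adj p q) (hdom : ∀ w, w ≠ p → w ≠ q → G.Adj p w ∨ G.Adj q w) :
    Fintype.card V ≤ mvc G + 1 := by
  have := card_sdiff_lt_mvc hG (cutConn_pair hpq) fun w hw => by
    rw [mem_insert, mem_singleton] at hw
    push Not at hw
    rcases hdom w hw.1 hw.2 with h | h
    · exact ⟨p, by simp, h⟩
    · exact ⟨q, by simp, h⟩
  rw [card_sdiff_of_subset (subset_univ _), card_univ, card_pair hpq.ne] at this
  omega

theorem three_le_mvc [Fintype V] (hG : G.Connected) (hV : 3 ≤ Fintype.card V) : 3 ≤ mvc G := by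
  have deg : ∀ a b c, b ≠ c → G.Adj a b → G.Adj a c → 3 ≤ mvc G := by
    intro a b c hbc hb hc
    have h1 := card_bd_lt_mvc hG (cutConn_singleton a)
    have h2 : #{b, c} ≤ #(bd G univ {a}) := card_le_card fun w hw => by
      rw [mem_insert, mem_singleton] at hw
      rw [mem_bd, mem_singleton]
      rcases hw with rfl | rfl
      · exact ⟨mem_univ _, hb.ne', a, by simp, hb⟩
      · exact ⟨mem_univ _, hc.ne', a, by simp, hc⟩
    rw [card_pair hbc] at h2
    omega
  have hne : ∀ A : Finset V, #A ≤ 2 → A ≠ univ := fun A hA h => by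
    rw [h, card_univ] at hA; omega
  obtain ⟨x⟩ := hG.nonempty
  obtain ⟨x', hx', y, -, -, hxy⟩ := hG.cutConn_univ.2 {x} (subset_univ _) (by simp)
    (hne _ (by simp))
  obtain ⟨a, ha, z, -, hz, haz⟩ := hG.cutConn_univ.2 {x', y} (subset_univ _) (by simp)
    (hne _ card_le_two)
  rw [mem_insert, mem_singleton] at ha hz
  push Not at hz
  rcases ha with rfl | rfl
  · exact deg a y z hz.2.symm hxy haz
  · exact deg a x' z hz.1.symm hxy.symm haz

end Colorings

section FewNonEdges

variable {V : Type*} [Fintype V] {G : SimpleGraph V}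

open Finset Classical

theorem ec_univ_eq_of_not_adj {x y : V} (hxy : x ≠ y) (hadj : ¬ G.Adj x y) :
    ec G univ univ = 2 * (#{z | G.Adj x z} + #{z | G.Adj y z})
      + ec G (univ \ {x, y}) (univ \ {x, y}) := by
  have hu : (univ : Finset V) = {x, y} ∪ univ \ {x, y} := by simp
  have hd : Disjoint ({x} : Finset V) {y} := by simpa using hxy
  have e0 : ec G {x, y} {x, y} = 0 := by
    refine ec_eq_zero fun a ha b hb => ?_
    rw [mem_insert, mem_singleton] at ha hb
    rcases ha with rfl | rfl <;> rcases hb with rfl | rfl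
    exacts [G.irrefl, hadj, fun h => hadj h.symm, G.irrefl]
  have e1 : ec G {x, y} (univ \ {x, y}) = #{z | G.Adj x z} + #{z | G.Adj y z} := by
    have : ({x, y} : Finset V) = {x} ∪ {y} := rfl
    rw [this, ec_union_left hd, ec_singleton_left, ec_singleton_left]
    congr 2
    · ext z; simp only [mem_filter, mem_sdiff, mem_union, mem_singleton, mem_univ, true_and]
      refine ⟨fun h => h.2, fun h => ⟨?_, h⟩⟩
      rintro (rfl | rfl)
      · exact h.ne rfl
      · exact hadj h
    · ext z; simp only [mem_filter, mem_sdiff, mem_union, mem_singleton, mem_univ, true_and]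
      refine ⟨fun h => h.2, fun h => ⟨?_, h⟩⟩
      rintro (rfl | rfl)
      · exact hadj h.symm
      · exact h.ne rfl
  conv_lhs => rw [hu]
  rw [ec_union_self disjoint_sdiff, e0, e1]; ring

/-- Two non-adjacent vertices without a common neighbour leave `n - 1` pairs non-adjacent: their own
pair, and one for each other vertex. -/
theorem diam_le_two_of_many_edges
    (he : Fintype.card V * (Fintype.card V - 1) < ec G univ univ + 2 * (Fintype.card V - 1))
    {x y : V} (hxy : x ≠ y) (hadj : ¬ G.Adj x y) : ∃ w, G.Adj x w ∧ G.Adj y w := by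
  by_contra hcon
  push Not at hcon
  have hR : #(univ \ {x, y} : Finset V) = Fintype.card V - 2 := by
    rw [card_sdiff_of_subset (subset_univ _), card_univ, card_pair hxy]
  have hV : 2 ≤ Fintype.card V := by
    rw [← card_pair hxy, ← card_univ]; exact card_le_card (subset_univ _)
  have h1 := ec_nonEdges_add (G := G) (univ \ {x, y})
  have h2 : #{z | G.Adj x z} + #{z | G.Adj y z} ≤ #(univ \ {x, y} : Finset V) := by
    rw [← card_union_of_disjoint]
    · refine card_le_card fun z hz => ?_
      simp only [mem_union, mem_filter, mem_univ, true_and] at hz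
      simp only [mem_sdiff, mem_univ, true_and, mem_insert, mem_singleton]
      rintro (rfl | rfl)
      · exact hz.elim (fun h => h.ne rfl) fun h => hadj h.symm
      · exact hz.elim hadj fun h => h.ne rfl
    · rw [disjoint_left]; intro z hz hz'
      exact hcon z (mem_filter.1 hz).2 (mem_filter.1 hz').2
  rw [ec_univ_eq_of_not_adj hxy hadj] at he
  rw [hR] at h1 h2
  obtain ⟨n, hn⟩ := Nat.exists_eq_add_of_le hV
  rw [hn] at he h1 h2
  rw [show 2 + n - 2 = n by omega] at h1 h2
  rw [show 2 + n - 1 = n + 1 by omega] at he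
  have : n * (n - 1) + n = n * n := by
    cases n with
    | zero => rfl
    | succ n => simp; ring
  nlinarith

/-- With two vertices `x`, `y` at distance at least three and no dominating edge, the neighbours of
`x` and of `y` lie in one component of the graph of non-adjacent pairs that avoid `x` and `y`, which
makes many pairs non-adjacent. -/
theorem exists_dominating_edge (hG : CutConn G univ)
    (he : Fintype.card V * (Fintype.card V - 1) < ec G univ univ + 4 * Fintype.card V - 8)
    {x y : V} (hxy : x ≠ y) (hadj : ¬ G.Adj x y) (hcon : ∀ w, G.Adj x w → ¬ G.Adj y w) :
    ∃ p q, G.Adj p q ∧ ∀ w, w ≠ p → w ≠ q → G.Adj p w ∨ G.Adj q w := by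
  by_contra hno
  push Not at hno
  have hR : #(univ \ {x, y} : Finset V) = Fintype.card V - 2 := by
    rw [card_sdiff_of_subset (subset_univ _), card_univ, card_pair hxy]
  have hV : 2 ≤ Fintype.card V := by
    rw [← card_pair hxy, ← card_univ]; exact card_le_card (subset_univ _)
  have h1 := ec_nonEdges_add (G := G) (univ \ {x, y})
  have nbr : ∀ a b : V, a ≠ b → ∃ z, G.Adj a z := by
    intro a b hab
    obtain ⟨a', ha', z, -, -, h⟩ := hG.2 {a} (subset_univ _) (by simp)
      (fun h => hab (mem_singleton.1 (h.symm ▸ mem_univ b : b ∈ ({a} : Finset V))).symm)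
    rw [mem_singleton] at ha'; subst ha'
    exact ⟨z, h⟩
  have hRx : ∀ z, G.Adj x z → z ∈ univ \ {x, y} := by
    intro z hz
    simp only [mem_sdiff, mem_univ, true_and, mem_insert, mem_singleton]
    rintro (rfl | rfl)
    exacts [hz.ne rfl, hadj hz]
  have hRy : ∀ z, G.Adj y z → z ∈ univ \ {x, y} := by
    intro z hz
    simp only [mem_sdiff, mem_univ, true_and, mem_insert, mem_singleton]
    rintro (rfl | rfl)
    exacts [hadj hz.symm, hz.ne rfl]
  have key : ∀ a b, G.Adj x a → G.Adj y b → (nonEdges G (univ \ {x, y})).Reachable a b := by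
    intro a b ha hb
    have hab : a ≠ b := fun h => hcon a ha (h ▸ hb)
    by_cases h : G.Adj a b
    · obtain ⟨w, h1, h2, h3, h4⟩ := hno a b h
      have hw : w ∈ univ \ {x, y} := by
        simp only [mem_sdiff, mem_univ, true_and, mem_insert, mem_singleton]
        rintro (rfl | rfl)
        exacts [h3 ha.symm, h4 hb.symm]
      have a1 : (nonEdges G (univ \ {x, y})).Adj a w := ⟨h1.symm, h3, hRx a ha, hw⟩
      have a2 : (nonEdges G (univ \ {x, y})).Adj b w := ⟨h2.symm, h4, hRy b hb, hw⟩
      exact a1.reachable.trans a2.symm.reachable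
    · exact (show (nonEdges G (univ \ {x, y})).Adj a b from
        ⟨hab, h, hRx a ha, hRy b hb⟩).reachable
  obtain ⟨a₀, ha₀⟩ := nbr x y hxy
  obtain ⟨b₀, hb₀⟩ := nbr y x hxy.symm
  have hP := card_le_ncard_edgeSet_add_one (G := nonEdges G (univ \ {x, y}))
    (P := (univ.filter fun z => G.Adj x z) ∪ univ.filter fun z => G.Adj y z) (fun p hp q hq => by
      simp only [mem_union, mem_filter, mem_univ, true_and] at hp hq
      rcases hp with hp | hp <;> rcases hq with hq | hq
      · exact (key p b₀ hp hb₀).trans (key q b₀ hq hb₀).symm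
      · exact key p q hp hq
      · exact (key q p hq hp).symm
      · exact (key a₀ p ha₀ hp).symm.trans (key a₀ q ha₀ hq))
  rw [card_union_of_disjoint] at hP
  · rw [ec_univ_eq_of_not_adj hxy hadj] at he
    rw [ec_univ, hR] at h1
    obtain ⟨n, hn⟩ := Nat.exists_eq_add_of_le hV
    rw [hn] at he h1
    rw [show 2 + n - 2 = n by omega] at h1
    rw [show 2 + n - 1 = n + 1 by omega] at he
    have h3 : n * (n - 1) + n = n * n := by
      cases n with
      | zero => rfl
      | succ n => simp; ring
    have h4 : (2 + n) * (n + 1) = n * n + 3 * n + 2 := by ring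
    omega
  · rw [disjoint_left]; intro z hz hz'
    exact hcon z (mem_filter.1 hz).2 (mem_filter.1 hz').2

end FewNonEdges

/-! ### Extremal graphs -/

section ThreeColors

/-- Half of `no_three_free_colors`, up to reflection of the cycle. -/
theorem no_three_free_colors_of_left {q : ℕ} (hq : 5 ≤ q) {c : ℕ → ℕ} {Φ : Set ℕ}
    (hF : ∀ i < q, (∃ a, ∀ x < i, c x = a) ∨ ∃ a, ∀ x, i < x → x < q → c x = a)
    (hP : ∀ i j, i < j → j < q → (∃ a, ∀ x, i < x → x < j → c x = a) ∨
      ∃ a ∈ Φ, (∀ x < i, c x = a) ∧ ∀ x, j < x → x < q → c x = a)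
    {x y z : ℕ} (hxy : x < y) (hyz : y < z) (hz : z < q) (h1 : c x ≠ c y)
    (h2 : c y ≠ c z) (hx' : c x ∉ Φ) (hz' : c z ∉ Φ)
    (hleft : ∃ a, ∀ w < y, c w = a) : False := by
  obtain ⟨a, ha⟩ := hleft
  have hxa := ha x hxy
  have h0a := ha 0 (by omega)
  have hin : ∀ i j, 1 ≤ i → i < j → j < q → ∃ a, ∀ x, i < x → x < j → c x = a := by
    intro i j hi hij hj
    refine (hP i j hij hj).resolve_right ?_
    rintro ⟨b, hb, hb1, -⟩
    rw [hxa, ← h0a, hb1 0 (by omega)] at hx'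
    exact hx' hb
  obtain ⟨d, hd⟩ := hin 1 (q - 1) le_rfl (by omega) (by omega)
  by_cases hy : 2 ≤ y
  · have hyd := hd y (by omega) (by omega)
    have hzq : z = q - 1 := by
      by_contra hne
      exact h2 (hyd.trans (hd z (by omega) (by omega)).symm)
    rcases hP 0 (q - 2) (by omega) (by omega) with ⟨b, hb⟩ | ⟨b, hb, -, hb2⟩
    · have e1 := hb 1 (by omega) (by omega)
      have e2 := hb 2 (by omega) (by omega)
      have e3 := hd 2 (by omega) (by omega)
      have e4 := ha 1 (by omega)
      exact h1 (by omega)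
    · rw [hb2 z (by omega) hz] at hz'
      exact hz' hb
  · obtain rfl : y = 1 := by omega
    obtain rfl : x = 0 := by omega
    rcases hF 2 (by omega) with ⟨b, hb⟩ | ⟨b, hb⟩
    · exact h1 ((hb 0 (by omega)).trans (hb 1 (by omega)).symm)
    · have e1 := hb (q - 1) (by omega) (by omega)
      have e2 := hb (q - 2) (by omega) (by omega)
      have e3 := hd (q - 2) (by omega) (by omega)
      have hzd : c z = d := by
        by_cases hne : z = q - 1
        · rw [hne]; omega
        · exact hd z (by omega) (by omega)
      rcases hP 0 (q - 2) (by omega) (by omega) with ⟨b', hb'⟩ | ⟨b', hb', -, hb2⟩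
      · have e4 := hb' 1 (by omega) (by omega)
        have e5 := hb' 2 (by omega) (by omega)
        have e6 := hd 2 (by omega) (by omega)
        exact h2 (by omega)
      · have e4 := hb2 (q - 1) (by omega) (by omega)
        rw [show c z = b' by omega] at hz'
        exact hz' hb'

/-- A path `0, …, q - 1` whose ends are joined through a further part of the graph with colour set
`Φ` carries at most two colours outside `Φ`. The hypotheses say what a vertex-monochromatic path
needs: from `i` into the further part it runs over all vertices on one side of `i`, and from `i` to
`j` it runs over all vertices in between or over all others and through the further part. -/
theorem no_three_free_colors {q : ℕ} (hq : 5 ≤ q) {c : ℕ → ℕ} {Φ : Set ℕ}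
    (hF : ∀ i < q, (∃ a, ∀ x < i, c x = a) ∨ ∃ a, ∀ x, i < x → x < q → c x = a)
    (hP : ∀ i j, i < j → j < q → (∃ a, ∀ x, i < x → x < j → c x = a) ∨
      ∃ a ∈ Φ, (∀ x < i, c x = a) ∧ ∀ x, j < x → x < q → c x = a)
    {x y z : ℕ} (hxy : x < y) (hyz : y < z) (hz : z < q) (h1 : c x ≠ c y)
    (h2 : c y ≠ c z) (hx' : c x ∉ Φ) (hz' : c z ∉ Φ) : False := by
  rcases hF y (by omega) with hl | ⟨a, ha⟩
  · exact no_three_free_colors_of_left hq hF hP hxy hyz hz h1 h2 hx' hz' hl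
  · refine no_three_free_colors_of_left (c := fun i => c (q - 1 - i)) (Φ := Φ) (x := q - 1 - z)
      (y := q - 1 - y) (z := q - 1 - x) hq ?_ ?_ (by omega) (by omega) (by omega) ?_ ?_ ?_ ?_ ?_
    · intro i hi
      rcases hF (q - 1 - i) (by omega) with ⟨b, hb⟩ | ⟨b, hb⟩
      · exact Or.inr ⟨b, fun x h h' => hb _ (by omega)⟩
      · exact Or.inl ⟨b, fun x h => hb _ (by omega) (by omega)⟩
    · intro i j hij hj
      rcases hP (q - 1 - j) (q - 1 - i) (by omega) (by omega) with ⟨b, hb⟩ | ⟨b, hb, hb1, hb2⟩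
      · exact Or.inl ⟨b, fun x h h' => hb _ (by omega) (by omega)⟩
      · exact Or.inr ⟨b, hb, fun x h => hb2 _ (by omega) (by omega),
          fun x h h' => hb1 _ (by omega)⟩
    · simpa only [show q - 1 - (q - 1 - z) = z by omega, show q - 1 - (q - 1 - y) = y by omega]
        using h2.symm
    · simpa only [show q - 1 - (q - 1 - x) = x by omega, show q - 1 - (q - 1 - y) = y by omega]
        using h1.symm
    · simpa only [show q - 1 - (q - 1 - z) = z by omega] using hz'
    · simpa only [show q - 1 - (q - 1 - x) = x by omega] using hx'
    · exact ⟨a, fun w hw => ha _ (by omega) (by omega)⟩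

end ThreeColors

/-- The path on the vertices `s, …, q - 1`, the vertex `0` and a clique on the vertices
`q, …, n - 1`, every vertex of the clique being adjacent to `0` and to `q - 1`. For `s = 0` this is
a cycle of length `q + 1` with one vertex blown up to a clique; for `s = 1` the edge `{0, 1}` is
missing, which leaves a path with its second vertex blown up to a clique. -/
def cliqueCycle (n q s : ℕ) : SimpleGraph (Fin n) where
  Adj i j :=
    (i.1 < j.1 ∧ ((j.1 < q ∧ j.1 = i.1 + 1 ∧ s ≤ i.1) ∨
      (q ≤ j.1 ∧ (i.1 = 0 ∨ i.1 + 1 = q ∨ q ≤ i.1))))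
    ∨ (j.1 < i.1 ∧ ((i.1 < q ∧ i.1 = j.1 + 1 ∧ s ≤ j.1) ∨
      (q ≤ i.1 ∧ (j.1 = 0 ∨ j.1 + 1 = q ∨ q ≤ j.1))))
  symm := ⟨fun _ _ h => h.symm⟩
  loopless := ⟨fun _ h => by omega⟩

section CliqueCycle

open Finset Classical

theorem cliqueCycle_adj {n q s : ℕ} {i j : Fin n} : (cliqueCycle n q s).Adj i j ↔
    (i.1 < j.1 ∧ ((j.1 < q ∧ j.1 = i.1 + 1 ∧ s ≤ i.1) ∨
      (q ≤ j.1 ∧ (i.1 = 0 ∨ i.1 + 1 = q ∨ q ≤ i.1))))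
    ∨ (j.1 < i.1 ∧ ((i.1 < q ∧ i.1 = j.1 + 1 ∧ s ≤ j.1) ∨
      (q ≤ i.1 ∧ (j.1 = 0 ∨ j.1 + 1 = q ∨ q ≤ j.1)))) := Iff.rfl

theorem cliqueCycle_connected {n q s : ℕ} (hn : q < n) (hs : s ≤ 1) :
    (cliqueCycle n q s).Connected := by
  rw [SimpleGraph.connected_iff_exists_forall_reachable]
  refine ⟨⟨q, hn⟩, fun w => ?_⟩
  rcases Nat.lt_trichotomy w.1 q with h | h | h
  · by_cases h0 : w.1 = 0
    · refine SimpleGraph.Adj.reachable (cliqueCycle_adj.2 ?_)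
      simp only; omega
    · obtain ⟨d, hd⟩ := Nat.exists_eq_add_of_lt h
      induction d generalizing w with
      | zero =>
        refine SimpleGraph.Adj.reachable (cliqueCycle_adj.2 ?_)
        simp only; omega
      | succ d ih =>
        refine (ih ⟨w.1 + 1, by omega⟩ (by simp only; omega) (by simp) (by simp only; omega)).trans
          (SimpleGraph.Adj.reachable (cliqueCycle_adj.2 ?_))
        exact Or.inr ⟨Nat.lt_succ_self _, Or.inl ⟨by simp only; omega, rfl, by omega⟩⟩
  · obtain rfl : w = ⟨q, hn⟩ := Fin.ext h
    rfl
  · refine SimpleGraph.Adj.reachable (cliqueCycle_adj.2 ?_)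
    simp only; omega

/-- Each edge is counted at its larger end. -/
theorem sum_backDegree_le {n : ℕ} (G : SimpleGraph (Fin n)) (f : ℕ → ℕ)
    (hf : ∀ j : Fin n, f j ≤ #{i | i < j ∧ G.Adj i j}) :
    ∑ j ∈ range n, f j ≤ G.edgeSet.ncard := by
  have h1 : ec G univ univ = ∑ j : Fin n, #{i | i < j ∧ G.Adj i j}
      + ∑ j : Fin n, #{i | j < i ∧ G.Adj i j} := by
    unfold ec
    rw [← sum_add_distrib]
    refine sum_congr rfl fun j _ => ?_
    rw [← card_union_of_disjoint]
    · congr 1; ext i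
      simp only [mem_union, mem_filter, mem_univ, true_and]
      constructor
      · intro h
        rcases lt_or_gt_of_ne h.ne with h' | h'
        · exact Or.inr ⟨h', h.symm⟩
        · exact Or.inl ⟨h', h.symm⟩
      · rintro (h | h) <;> exact h.2.symm
    · rw [disjoint_left]; intro i h1 h2
      exact lt_asymm (mem_filter.1 h1).2.1 (mem_filter.1 h2).2.1
  have h2 : ∑ j : Fin n, #{i | j < i ∧ G.Adj i j} = ∑ j : Fin n, #{i | i < j ∧ G.Adj i j} := by
    simp_rw [card_filter]
    rw [sum_comm]
    simp_rw [G.adj_comm]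
  rw [ec_univ, h2] at h1
  rw [← Fin.sum_univ_eq_sum_range]
  have := sum_le_sum fun (j : Fin n) (_ : j ∈ univ) => hf j
  omega

theorem le_ncard_edgeSet_cliqueCycle {q p s : ℕ} (hq : 2 ≤ q) :
    q - 1 - s + 2 * p + p.choose 2 ≤ (cliqueCycle (q + p) q s).edgeSet.ncard := by
  refine le_trans (le_of_eq ?_) (sum_backDegree_le _
    (fun j => if j < q then (if s < j then 1 else 0) else 2 + (j - q)) fun j => ?_)
  · rw [sum_range_add]
    have h1 : ∑ j ∈ range q, (if j < q then (if s < j then 1 else 0) else 2 + (j - q))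
        = q - 1 - s := by
      rw [sum_congr rfl (g := fun j => if s < j then 1 else 0)
        (fun j hj => by rw [if_pos (mem_range.1 hj)]), ← card_filter]
      have : (range q).filter (s < ·) = Ico (s + 1) q := by
        ext j; simp only [mem_filter, mem_range, mem_Ico]; omega
      rw [this, Nat.card_Ico]; omega
    have h2 : ∑ l ∈ range p, (if q + l < q then (if s < q + l then 1 else 0)
        else 2 + (q + l - q)) = 2 * p + p.choose 2 := by
      rw [sum_congr rfl (g := fun l => 2 + l) (fun l _ => by rw [if_neg (by omega)]; omega),
        sum_add_distrib, sum_range_id, Nat.choose_two_right]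
      simp [mul_comm]
    rw [h1, h2]; ring
  · split_ifs with h1 h2
    · refine card_pos.2 ⟨⟨j.1 - 1, by omega⟩, mem_filter.2 ⟨mem_univ _, ?_, cliqueCycle_adj.2 ?_⟩⟩
      · rw [Fin.lt_def]; simp only; omega
      · simp only; omega
    · exact Nat.zero_le _
    · have hlt : ∀ m ∈ insert 0 (insert (q - 1) (Ico q j.1)), m < q + p := by
        intro m hm
        rw [mem_insert, mem_insert, mem_Ico] at hm
        have := j.2
        omega
      have hc : #(attachFin _ hlt) = 2 + (j.1 - q) := by
        rw [card_attachFin, card_insert_of_notMem, card_insert_of_notMem, Nat.card_Ico]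
        · ring
        · rw [mem_Ico]; omega
        · rw [mem_insert, mem_Ico]; omega
      rw [← hc]
      refine card_le_card fun i hi => ?_
      rw [mem_attachFin, mem_insert, mem_insert, mem_Ico] at hi
      refine mem_filter.2 ⟨mem_univ _, ?_, cliqueCycle_adj.2 ?_⟩
      · rw [Fin.lt_def]; omega
      · omega

theorem exists_mem_support_of_mem_of_notMem {V : Type*} {G : SimpleGraph V} {u v : V}
    (p : G.Walk u v) (S : Set V) (hu : u ∈ S) (hv : v ∉ S) :
    ∃ x ∈ S, ∃ y ∉ S, y ∈ p.support ∧ G.Adj x y := by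
  obtain ⟨d, hd, h1, h2⟩ := p.exists_boundary_dart S hu hv
  exact ⟨d.fst, h1, d.snd, h2, p.dart_snd_mem_support_of_mem_darts hd, d.adj⟩

/-- A colouring in which at most two colours occur only outside the clique uses at most `p + 2`
colours, where `p` is the size of the clique. -/
theorem ncard_range_le_of_free_colors {q p : ℕ} {c : Fin (q + p) → ℕ}
    (h : ∀ x y z : Fin (q + p), x.1 < q → y.1 < q → z.1 < q → c x ≠ c y → c x ≠ c z → c y ≠ c z →
      (∀ f : Fin (q + p), q ≤ f.1 → c f ≠ c x) → (∀ f : Fin (q + p), q ≤ f.1 → c f ≠ c y) →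
      (∀ f : Fin (q + p), q ≤ f.1 → c f ≠ c z) → False) :
    (Set.range c).ncard ≤ p + 2 := by
  set F : Finset (Fin (q + p)) := {f | q ≤ f.1} with hF
  set A : Finset ℕ := univ.image c \ F.image c with hA
  have hFc : #F ≤ p := by
    have hsub : F ⊆ attachFin (Ico q (q + p)) (fun m hm => (mem_Ico.1 hm).2) := by
      intro f hf
      rw [mem_attachFin, mem_Ico]
      exact ⟨(mem_filter.1 hf).2, f.2⟩
    refine (card_le_card hsub).trans ?_
    rw [card_attachFin, Nat.card_Ico]; omega
  have hAc : #A ≤ 2 := by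
    by_contra hcon
    push Not at hcon
    obtain ⟨a, ha, b, hb, d, hd, hab, had, hbd⟩ := two_lt_card.1 hcon
    have hex : ∀ a ∈ A, ∃ x : Fin (q + p), x.1 < q ∧ c x = a ∧
        ∀ f : Fin (q + p), q ≤ f.1 → c f ≠ c x := by
      intro a ha
      rw [hA, mem_sdiff, mem_image, mem_image] at ha
      obtain ⟨⟨x, -, rfl⟩, hx⟩ := ha
      have hx' : ∀ f : Fin (q + p), q ≤ f.1 → c f ≠ c x :=
        fun f hf hc => hx ⟨f, by simp [hF, hf], hc⟩
      refine ⟨x, ?_, rfl, hx'⟩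
      by_contra hlt
      exact hx' x (by omega) rfl
    obtain ⟨x, hx, rfl, hx'⟩ := hex a ha
    obtain ⟨y, hy, rfl, hy'⟩ := hex b hb
    obtain ⟨z, hz, rfl, hz'⟩ := hex d hd
    exact h x y z hx hy hz hab had hbd hx' hy' hz'
  rw [← Set.image_univ, ← coe_univ, ← coe_image, Set.ncard_coe_finset]
  have h1 : #(univ.image c) ≤ #A + #(F.image c) := by
    rw [hA, add_comm #(univ.image c \ F.image c)]
    exact (card_le_card (by simp)).trans (card_union_le (F.image c) (univ.image c \ F.image c))
  have h2 : #(F.image c) ≤ #F := card_image_le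
  omega

theorem mvc_cliqueCycle_one_le {q p : ℕ} (hq : 3 ≤ q) (hp : 1 ≤ p) :
    mvc (cliqueCycle (q + p) q 1) ≤ p + 2 := by
  obtain ⟨⟨c, hc, hm⟩, -⟩ := mvc_isGreatest _
    (cliqueCycle_connected (n := q + p) (q := q) (s := 1) (by omega) le_rfl)
  rw [← hm]
  -- A path from `1` to `0` passes through all of `2, …, q - 1` and through the clique.
  obtain ⟨w, -, a, ha⟩ := hc ⟨1, by omega⟩ ⟨0, by omega⟩
  have hall : ∀ y : Fin (q + p), 2 ≤ y.1 → y.1 < q → c y = a := by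
    intro y h2 hyq
    obtain ⟨x, hx, z, hz, hzs, hadj⟩ := exists_mem_support_of_mem_of_notMem w
      {x | 1 ≤ x.1 ∧ x.1 < y.1} ⟨le_rfl, h2⟩ (by simp)
    rw [Set.mem_ofPred_eq] at hx hz
    rw [cliqueCycle_adj] at hadj
    obtain rfl : z = y := Fin.ext (by omega)
    exact ha z hzs (by rw [Ne, Fin.ext_iff]; simp only; omega)
      (by rw [Ne, Fin.ext_iff]; simp only; omega)
  have hf : ∃ f : Fin (q + p), q ≤ f.1 ∧ c f = a := by
    obtain ⟨x, hx, z, hz, hzs, hadj⟩ := exists_mem_support_of_mem_of_notMem w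
      {x | 1 ≤ x.1 ∧ x.1 < q} (by simp; omega) (by simp)
    rw [Set.mem_ofPred_eq] at hx hz
    rw [cliqueCycle_adj] at hadj
    refine ⟨z, by omega, ha z hzs ?_ ?_⟩ <;> rw [Ne, Fin.ext_iff] <;> simp only <;> omega
  obtain ⟨f, hfq, hfa⟩ := hf
  refine ncard_range_le_of_free_colors fun x y z hx hy hz h1 h2 h3 hx' hy' hz' => ?_
  have hlt : ∀ x : Fin (q + p), x.1 < q → (∀ f : Fin (q + p), q ≤ f.1 → c f ≠ c x) → x.1 < 2 := by
    intro x hx hx'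
    by_contra hcon
    exact hx' f hfq (by rw [hfa, hall x (by omega) hx])
  have e1 := hlt x hx hx'
  have e2 := hlt y hy hy'
  have e3 := hlt z hz hz'
  have n1 : x.1 ≠ y.1 := fun h => h1 (congrArg c (Fin.ext h))
  have n2 : x.1 ≠ z.1 := fun h => h2 (congrArg c (Fin.ext h))
  have n3 : y.1 ≠ z.1 := fun h => h3 (congrArg c (Fin.ext h))
  omega

theorem mvc_cliqueCycle_zero_le {q p : ℕ} (hq : 5 ≤ q) (hp : 1 ≤ p) :
    mvc (cliqueCycle (q + p) q 0) ≤ p + 2 := by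
  obtain ⟨⟨c, hc, hm⟩, -⟩ := mvc_isGreatest _
    (cliqueCycle_connected (n := q + p) (q := q) (s := 0) (by omega) (by omega))
  rw [← hm]
  set c' : ℕ → ℕ := fun i => if h : i < q + p then c ⟨i, h⟩ else 0 with hc'
  have hcc : ∀ x : Fin (q + p), c' x.1 = c x := fun x => by simp [hc']
  set Φ : Set ℕ := {a | ∃ f : Fin (q + p), q ≤ f.1 ∧ c f = a} with hΦ
  have hF : ∀ i < q, (∃ a, ∀ x < i, c' x = a) ∨ ∃ a, ∀ x, i < x → x < q → c' x = a := by
    intro i hi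
    obtain ⟨w, -, a, ha⟩ := hc ⟨i, by omega⟩ ⟨q, by omega⟩
    by_contra hcon
    push Not at hcon
    obtain ⟨x, hx, hxa⟩ := hcon.1 a
    obtain ⟨y, hy, hyq, hya⟩ := hcon.2 a
    obtain ⟨s, hs, t, ht, hts, hadj⟩ := exists_mem_support_of_mem_of_notMem w
      {z | x < z.1 ∧ z.1 < y} (by simp; omega) (by simp; omega)
    rw [Set.mem_ofPred_eq] at hs ht
    rw [cliqueCycle_adj] at hadj
    have hta := ha t hts (by rw [Ne, Fin.ext_iff]; simp only; omega)
      (by rw [Ne, Fin.ext_iff]; simp only; omega)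
    rw [← hcc] at hta
    rcases (show t.1 = x ∨ t.1 = y by omega) with h | h
    · exact hxa (h ▸ hta)
    · exact hya (h ▸ hta)
  have hP : ∀ i j, i < j → j < q → (∃ a, ∀ x, i < x → x < j → c' x = a) ∨
      ∃ a ∈ Φ, (∀ x < i, c' x = a) ∧ ∀ x, j < x → x < q → c' x = a := by
    intro i j hij hj
    obtain ⟨w, -, a, ha⟩ := hc ⟨i, by omega⟩ ⟨j, by omega⟩
    refine or_iff_not_imp_left.2 fun hcon => ?_
    push Not at hcon
    -- The path avoids a vertex `x` between `i` and `j`, so it takes the other way round.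
    obtain ⟨x, hix, hxj, hxa⟩ := hcon a
    refine ⟨a, ?_, fun y hy => ?_, fun y hy hyq => ?_⟩
    · obtain ⟨s, hs, t, ht, hts, hadj⟩ := exists_mem_support_of_mem_of_notMem w
        {z | z.1 < x} (by simp; omega) (by simp; omega)
      rw [Set.mem_ofPred_eq] at hs ht
      rw [cliqueCycle_adj] at hadj
      by_cases htx : t.1 = x
      · have hta := ha t hts (by rw [Ne, Fin.ext_iff]; simp only; omega)
          (by rw [Ne, Fin.ext_iff]; simp only; omega)
        rw [← hcc] at hta
        exact absurd (htx ▸ hta) hxa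
      · exact ⟨t, by omega, ha t hts (by rw [Ne, Fin.ext_iff]; simp only; omega)
          (by rw [Ne, Fin.ext_iff]; simp only; omega)⟩
    · obtain ⟨s, hs, t, ht, hts, hadj⟩ := exists_mem_support_of_mem_of_notMem w
        {z | y < z.1 ∧ z.1 < x} (by simp; omega) (by simp; omega)
      rw [Set.mem_ofPred_eq] at hs ht
      rw [cliqueCycle_adj] at hadj
      have hta := ha t hts (by rw [Ne, Fin.ext_iff]; simp only; omega)
        (by rw [Ne, Fin.ext_iff]; simp only; omega)
      rw [← hcc] at hta
      rcases (show t.1 = x ∨ t.1 = y by omega) with h | h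
      · exact absurd (h ▸ hta) hxa
      · exact h ▸ hta
    · obtain ⟨s, hs, t, ht, hts, hadj⟩ := exists_mem_support_of_mem_of_notMem w
        {z | z.1 < x ∨ y < z.1} (by simp; omega) (by simp; omega)
      rw [Set.mem_ofPred_eq] at hs ht
      rw [cliqueCycle_adj] at hadj
      have hta := ha t hts (by rw [Ne, Fin.ext_iff]; simp only; omega)
        (by rw [Ne, Fin.ext_iff]; simp only; omega)
      rw [← hcc] at hta
      rcases (show t.1 = x ∨ t.1 = y by omega) with h | h
      · exact absurd (h ▸ hta) hxa
      · exact h ▸ hta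
  refine ncard_range_le_of_free_colors fun x y z hx hy hz h1 h2 h3 hx' hy' hz' => ?_
  have main : ∀ x y z : Fin (q + p), x.1 < y.1 → y.1 < z.1 → z.1 < q → c x ≠ c y → c y ≠ c z →
      (∀ f : Fin (q + p), q ≤ f.1 → c f ≠ c x) → (∀ f : Fin (q + p), q ≤ f.1 → c f ≠ c z) →
      False := by
    intro x y z hxy hyz hz h1 h2 hx' hz'
    refine no_three_free_colors hq hF hP hxy hyz hz ?_ ?_ ?_ ?_ <;> simp only [hcc]
    · exact h1
    · exact h2
    · rintro ⟨f, hf, h⟩; exact hx' f hf h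
    · rintro ⟨f, hf, h⟩; exact hz' f hf h
  have n1 : x.1 ≠ y.1 := fun h => h1 (congrArg c (Fin.ext h))
  have n2 : x.1 ≠ z.1 := fun h => h2 (congrArg c (Fin.ext h))
  have n3 : y.1 ≠ z.1 := fun h => h3 (congrArg c (Fin.ext h))
  rcases lt_or_gt_of_ne n1 with a | a <;> rcases lt_or_gt_of_ne n2 with b | b <;>
    rcases lt_or_gt_of_ne n3 with d | d
  · exact main x y z a d hz h1 h3 hx' hz'
  · exact main x z y b d hy h2 h3.symm hx' hy'
  · omega
  · exact main z x y b a hy h2.symm h1 hz' hy'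
  · exact main y x z a b hz h1.symm h2 hy' hz'
  · omega
  · exact main y z x d b hx h3 h2.symm hy' hx'
  · exact main z y x d a hx h3.symm h1.symm hz' hx'

end CliqueCycle

/-! ### The forcing edge numbers -/

section ForcingEdgeNumbers

open Finset Classical

theorem le_mvc_of_large_edgeSet {n k : ℕ} (hk : 4 ≤ k) (hkn : k + 2 ≤ n) {G : SimpleGraph (Fin n)}
    (hG : G.Connected) (he : n + (k - 2).choose 2 ≤ G.edgeSet.ncard) : k ≤ mvc G := by
  by_contra hlt
  have hL : ∀ X, CutConn G X → #(bd G univ X) ≤ k - 2 := fun X hX => by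
    have := card_bd_lt_mvc hG hX
    omega
  have := ec_univ_le_of_card_bd_le hG.cutConn_univ hL (by rw [Fintype.card_fin]; omega)
  rw [ec_univ, Fintype.card_fin] at this
  have h2 : (k - 2) * (k - 2 - 1) = 2 * (k - 2).choose 2 := by
    rw [Nat.choose_two_right, Nat.mul_div_cancel' (Nat.even_mul_pred_self _).two_dvd]
  omega

theorem le_mvc_of_edgeSet_of_le_succ {n k : ℕ} (hk : 3 ≤ k) (hkn : k ≤ n) (hnk : n ≤ k + 1)
    {G : SimpleGraph (Fin n)} (hG : G.Connected)
    (he : n - 1 + (k - 2).choose 2 ≤ G.edgeSet.ncard) : k ≤ mvc G := by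
  have h2 : 2 * (k - 2).choose 2 = (k - 2) * (k - 2 - 1) := by
    rw [Nat.choose_two_right, Nat.mul_div_cancel' (Nat.even_mul_pred_self _).two_dvd]
  obtain ⟨m, rfl⟩ := Nat.exists_eq_add_of_le hk
  rw [show 3 + m - 2 = m + 1 by omega, show m + 1 - 1 = m by omega] at h2
  rw [show 3 + m - 2 = m + 1 by omega] at he
  by_cases hdiam : ∀ u v, u ≠ v → ¬ G.Adj u v → ∃ w, G.Adj u w ∧ G.Adj v w
  · have := card_le_mvc_of_diam_le_two hG hdiam
    rw [Fintype.card_fin] at this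
    omega
  push Not at hdiam
  obtain ⟨x, y, hxy, hadj, hcon⟩ := hdiam
  rcases (show n = 3 + m ∨ n = 4 + m by omega) with rfl | rfl
  · obtain ⟨w, h1, h2⟩ := diam_le_two_of_many_edges (G := G) (by
      rw [ec_univ, Fintype.card_fin, show 3 + m - 1 = m + 2 by omega]
      rw [show 3 + m - 1 = m + 2 by omega] at he
      have : (3 + m) * (m + 2) = (m + 1) * m + 4 * m + 6 := by ring
      omega) hxy hadj
    exact absurd h2 (hcon w h1)
  · obtain ⟨p, q, hpq, hdom⟩ := exists_dominating_edge hG.cutConn_univ (by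
      rw [ec_univ, Fintype.card_fin, show 4 + m - 1 = m + 3 by omega]
      rw [show 4 + m - 1 = m + 3 by omega] at he
      have : (4 + m) * (m + 3) = (m + 1) * m + 6 * m + 12 := by ring
      omega) hxy hadj hcon
    have := card_le_mvc_add_one_of_dominating_edge hG hpq hdom
    rw [Fintype.card_fin] at this
    omega

theorem choose_two_succ_add (p : ℕ) : (p + 1).choose 2 = p.choose 2 + p := by
  rw [Nat.choose_succ_succ' p 1, Nat.choose_one_right, add_comm]

theorem isLeast_forcingEdgeNumbers_three {n : ℕ} (hn : 3 ≤ n) :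
    IsLeast (forcingEdgeNumbers n 3) (n - 1) :=
  ⟨⟨le_rfl, fun _ hG _ => three_le_mvc hG (by rwa [Fintype.card_fin])⟩, fun _ hm => hm.1⟩

theorem isLeast_forcingEdgeNumbers_middle {n k : ℕ} (hk : 4 ≤ k) (hkn : k + 2 ≤ n) :
    IsLeast (forcingEdgeNumbers n k) (n + (k - 2).choose 2) := by
  refine ⟨⟨by omega, fun G hG he => le_mvc_of_large_edgeSet hk hkn hG he⟩, fun m hm => ?_⟩
  by_contra hlt
  obtain ⟨p, hp, rfl⟩ : ∃ p, 1 ≤ p ∧ k = p + 3 := ⟨k - 3, by omega, by omega⟩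
  obtain ⟨q, hq, rfl⟩ : ∃ q, 5 ≤ q ∧ n = q + p := ⟨n - p, by omega, by omega⟩
  have h1 := le_ncard_edgeSet_cliqueCycle (q := q) (p := p) (s := 0) (by omega)
  have h2 := hm.2 _ (cliqueCycle_connected (n := q + p) (q := q) (s := 0) (by omega)
    (by omega)) (by
      rw [show p + 3 - 2 = p + 1 by omega, choose_two_succ_add] at hlt; omega)
  have h3 := mvc_cliqueCycle_zero_le hq hp
  omega

theorem isLeast_forcingEdgeNumbers_top {n k : ℕ} (hk : 4 ≤ k) (hkn : k ≤ n) (hnk : n ≤ k + 1) :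
    IsLeast (forcingEdgeNumbers n k) (n - 1 + (k - 2).choose 2) := by
  refine ⟨⟨by omega, fun G hG he => le_mvc_of_edgeSet_of_le_succ (by omega) hkn hnk hG he⟩,
    fun m hm => ?_⟩
  by_contra hlt
  obtain ⟨p, hp, rfl⟩ : ∃ p, 1 ≤ p ∧ k = p + 3 := ⟨k - 3, by omega, by omega⟩
  obtain ⟨q, hq, rfl⟩ : ∃ q, 3 ≤ q ∧ n = q + p := ⟨n - p, by omega, by omega⟩
  have h1 := le_ncard_edgeSet_cliqueCycle (q := q) (p := p) (s := 1) (by omega)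
  have h2 := hm.2 _ (cliqueCycle_connected (n := q + p) (q := q) (s := 1) (by omega)
    le_rfl) (by
      rw [show p + 3 - 2 = p + 1 by omega, choose_two_succ_add] at hlt; omega)
  have h3 := mvc_cliqueCycle_one_le hq hp
  omega

end ForcingEdgeNumbers

theorem corollary3p7 (n k : ℕ) (hk : 3 ≤ k) (hkn : k ≤ n) :
    IsLeast (forcingEdgeNumbers n k) (fv n k) ∧
    (k = 3 → fv n k = n - 1) ∧
    (4 ≤ k → k ≤ n - 2 → fv n k = n + (k - 2).choose 2) ∧
    (n - 1 ≤ k → fv n k = n - 1 + (k - 2).choose 2) := by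
  have fv_eq : ∀ {a}, IsLeast (forcingEdgeNumbers n k) a → fv n k = a := fun h => h.csInf_eq
  rcases (show k = 3 ∨ (4 ≤ k ∧ k + 2 ≤ n) ∨ (4 ≤ k ∧ n ≤ k + 1) by omega) with
    rfl | ⟨h, h'⟩ | ⟨h, h'⟩
  · have hl := isLeast_forcingEdgeNumbers_three hkn
    have e := fv_eq hl
    exact ⟨by rwa [e], fun _ => e, fun h => by omega, fun _ => by simpa [Nat.choose] using e⟩
  · have hl := isLeast_forcingEdgeNumbers_middle h h'
    have e := fv_eq hl
    exact ⟨by rwa [e], fun _ => by omega, fun _ _ => e, fun _ => by omega⟩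
  · have hl := isLeast_forcingEdgeNumbers_top h hkn h'
    have e := fv_eq hl
    exact ⟨by rwa [e], fun _ => by omega, fun _ _ => by omega, fun _ => e⟩
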